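/- Let $G\in C^1(\mathbb{R})$ and $g=G'$, with $G(0)=g(0)=0$ and $g$ non-decreasing and Lipschitz on $[0,\infty)$, and let $\theta>0$. Let $(u,w)$ be a classical solution of $$(-\Delta)^{1/2}u+u=\theta\,w\,g(u),\qquad (-\Delta)^{1/2}w=\pi\,G(u)\qquad\text{in }\mathbb{R},$$ that is, $u,w\in C^{1,1}_{\mathrm{loc}}(\mathbb{R})$ with $\int_{\mathbb{R}}\frac{|u(x)|+|w(x)|}{1+|x|^2}\,dx<\infty$, and both equations hold at every point of $\mathbb{R}$, where $$(-\Delta)^{1/2}\varphi(x)=\frac1\pi\,\mathrm{P.V.}\!\int_{\mathbb{R}}\frac{\varphi(x)-\varphi(y)}{|x-y|^2}\,dy .$$ Suppose that $u>0$ in $\mathbb{R}$, $u\in L^\infty(\mathbb{R})$, and $w(x)\to-\infty$ as $|x|\to\infty$. Then, up to a translation, $u$ is even and radially decreasing: there is $x_0\in\mathbb{R}$ such that $u(x_0+x)=u(x_0-x)$ for all $x\in\mathbb{R}$ and $r\mapsto u(x_0+r)$ is strictly decreasing on $[0,\infty)$. -/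

import Mathlib

/-- `φ ∈ C^{1,1}_loc(ℝ)`: `φ` is continuously differentiable and `φ'` is locally Lipschitz. -/
def IsC11Loc (φ : ℝ → ℝ) : Prop :=
  ContDiff ℝ 1 φ ∧ LocallyLipschitz (deriv φ)

/-- The weighted space `L_{1/2}(ℝ)`: locally integrable functions with
`∫ |φ(x)| / (1 + |x|²) dx < ∞`. -/
def MemLHalf (φ : ℝ → ℝ) : Prop :=
  MeasureTheory.LocallyIntegrable φ ∧
    MeasureTheory.Integrable (fun x : ℝ => |φ x| / (1 + |x| ^ 2))

/-- `(-Δ)^{1/2} φ (x) = L` pointwise: the principal value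
`(1/π) P.V. ∫ (φ(x) - φ(y)) / |x - y|² dy` exists and equals `L`. The normalization constant
of the half-Laplacian on the line is `1/π`. For `φ ∈ L_{1/2}(ℝ)` the truncated integrals
converge absolutely. -/
def HasHalfLaplacianAt (φ : ℝ → ℝ) (L x : ℝ) : Prop :=
  Filter.Tendsto
    (fun ε : ℝ => (1 / Real.pi) * ∫ y in {y : ℝ | ε < |x - y|}, (φ x - φ y) / |x - y| ^ 2)
    (nhdsWithin 0 (Set.Ioi 0)) (nhds L)

/-- `(u, w)` is a classical solution on `ℝ` of the system
`(-Δ)^{1/2} u + u = θ w G'(u)`, `(-Δ)^{1/2} w = π G(u)`. -/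
structure IsClassicalSolution (G : ℝ → ℝ) (θ : ℝ) (u w : ℝ → ℝ) : Prop where
  u_c11 : IsC11Loc u
  u_mem : MemLHalf u
  w_c11 : IsC11Loc w
  w_mem : MemLHalf w
  eq_u : ∀ x : ℝ, ∃ L : ℝ, HasHalfLaplacianAt u L x ∧ L + u x = θ * w x * deriv G (u x)
  eq_w : ∀ x : ℝ, HasHalfLaplacianAt w (Real.pi * G (u x)) x

/-!
The proof is by moving planes. Since `w → -∞` and `G' ≥ 0`, far from the origin `u` satisfies
`(-Δ)^{1/2} u + u ≤ 0`, and comparison with Lorentzian barriers gives `u = O(1 / x²)`. For a centre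
`c` the reflected differences `U s = u (c - s) - u (c + s)` and `W s = w (c - s) - w (c + s)` are
odd, and the half-Laplacian of an odd function at a minimum `a > 0` over the half-line is at most
`2 / (π a)` times the minimal value. As `w` is superharmonic, `W` is bounded below by a sublinear
function; adding `κ s`, which second differences do not see, and letting `κ → 0` then bounds `W`
from below by a multiple of `min U`. This decouples the system: at a negative minimum `a` of `U` the
quantity `2 / a + π` is bounded by a coefficient that vanishes as `c + a → ∞`. So negative minima
stay at a positive distance from the centre and in a compact set, and at the supremum of the centres
for which `U` takes negative values the strong maximum principle forces `U = 0`. A second centre of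
symmetry would make `u` periodic, contradicting `0 < u → 0`; this makes the monotonicity strict.
-/

open MeasureTheory Set Filter Topology
open scoped Real

/-- The symmetric second difference of `φ` at `x`, with the sign of `(-Δ)^{1/2}`. -/
def secondDifference (φ : ℝ → ℝ) (x z : ℝ) : ℝ :=
  2 * φ x - φ (x + z) - φ (x - z)

/-- `ℓ = π (-Δ)^{1/2} φ (x)`, read as the improper integral of
`(2φ(x) - φ(x+z) - φ(x-z)) / z²` over `z > 0`, absolutely convergent at infinity and possibly only
conditionally convergent at `0`. Affine functions have vanishing second differences, so this form of
the operator also applies to functions of linear growth, which do not belong to `L_{1/2}`. -/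
structure HasSecondDifferenceIntegral (φ : ℝ → ℝ) (ℓ x : ℝ) : Prop where
  integrableOn : ∀ ⦃ε : ℝ⦄, 0 < ε → IntegrableOn (fun z => secondDifference φ x z / z ^ 2) (Ioi ε)
  tendsto : Tendsto (fun ε : ℝ => ∫ z in Ioi ε, secondDifference φ x z / z ^ 2) (𝓝[>] 0) (𝓝 ℓ)

theorem measurableSet_lt_abs_sub (x ε : ℝ) : MeasurableSet {y : ℝ | ε < |x - y|} :=
  (isOpen_lt continuous_const (by fun_prop)).measurableSet

theorem one_add_sq_le_mul_sq {x y ε : ℝ} (hε : 0 < ε) (hy : ε < |x - y|) :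
    1 + y ^ 2 ≤ ((1 + 2 * x ^ 2) / ε ^ 2 + 2) * |x - y| ^ 2 := by
  have hnear : 1 + 2 * x ^ 2 ≤ (1 + 2 * x ^ 2) / ε ^ 2 * |x - y| ^ 2 := by
    rw [div_mul_eq_mul_div, le_div_iff₀ (by positivity)]
    gcongr
  rw [add_mul]
  nlinarith [sq_nonneg (2 * x - y), sq_abs (x - y)]

theorem MemLHalf.integrableOn_sub_div_sq {φ : ℝ → ℝ} (h : MemLHalf φ) (x : ℝ) {ε : ℝ}
    (hε : 0 < ε) : IntegrableOn (fun y => (φ x - φ y) / |x - y| ^ 2) {y : ℝ | ε < |x - y|} := by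
  have hmaj : Integrable fun y : ℝ => ((1 + 2 * x ^ 2) / ε ^ 2 + 2) *
      (|φ x| * (1 + y ^ 2)⁻¹ + |φ y| / (1 + |y| ^ 2)) :=
    ((integrable_inv_one_add_sq.const_mul _).add h.2).const_mul _
  have hmeas : AEMeasurable (fun y => (φ x - φ y) / |x - y| ^ 2) :=
    (aemeasurable_const.sub h.1.aestronglyMeasurable.aemeasurable).div (by fun_prop)
  refine hmaj.integrableOn.mono' hmeas.aestronglyMeasurable.restrict ?_
  refine (ae_restrict_iff' (measurableSet_lt_abs_sub x ε)).2 (Eventually.of_forall fun y hy => ?_)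
  have hdist : 0 < |x - y| := hε.trans hy
  have hkernel := one_add_sq_le_mul_sq hε hy
  rw [Real.norm_eq_abs, abs_div, abs_of_pos (pow_pos hdist 2), div_le_iff₀ (pow_pos hdist 2),
    sq_abs y]
  calc |φ x - φ y| ≤ |φ x| + |φ y| := by simpa using abs_sub (φ x) (φ y)
    _ = (|φ x| + |φ y|) / (1 + y ^ 2) * (1 + y ^ 2) := by field_simp
    _ ≤ (|φ x| + |φ y|) / (1 + y ^ 2) * (((1 + 2 * x ^ 2) / ε ^ 2 + 2) * |x - y| ^ 2) := by gcongr
    _ = _ := by ring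

theorem setOf_lt_abs_sub_eq_union (x ε : ℝ) :
    {y : ℝ | ε < |x - y|} = Ioi (x + ε) ∪ Iio (x - ε) := by
  ext y
  simp only [mem_ofPred_eq, mem_union, mem_Ioi, mem_Iio, lt_abs]
  constructor
  · rintro (h | h)
    · right; linarith
    · left; linarith
  · rintro (h | h)
    · right; linarith
    · left; linarith

section Fold

variable {f : ℝ → ℝ} {x ε : ℝ}

theorem integrableOn_Ioi_comp_add_left (hf : IntegrableOn f (Ioi (x + ε))) :
    IntegrableOn (fun z => f (x + z)) (Ioi ε) := by
  have hmp := ((measurePreserving_add_left volume x).integrableOn_comp_preimage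
    (MeasurableEquiv.addLeft x).measurableEmbedding).2 hf
  simpa [Function.comp_def] using hmp

theorem integrableOn_Ioi_comp_sub_left (hf : IntegrableOn f (Iio (x - ε))) :
    IntegrableOn (fun z => f (x - z)) (Ioi ε) := by
  have hmp := ((Measure.measurePreserving_sub_left volume x).integrableOn_comp_preimage
    (MeasurableEquiv.subLeft x).measurableEmbedding).2 hf
  simpa [Function.comp_def] using hmp

theorem setIntegral_Ioi_comp_add_left (f : ℝ → ℝ) (x ε : ℝ) :
    ∫ z in Ioi ε, f (x + z) = ∫ y in Ioi (x + ε), f y := by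
  have hmp := (measurePreserving_add_left volume x).setIntegral_preimage_emb
    (MeasurableEquiv.addLeft x).measurableEmbedding f (Ioi (x + ε))
  simpa using hmp

theorem setIntegral_Ioi_comp_sub_left (f : ℝ → ℝ) (x ε : ℝ) :
    ∫ z in Ioi ε, f (x - z) = ∫ y in Iio (x - ε), f y := by
  have hmp := (Measure.measurePreserving_sub_left volume x).setIntegral_preimage_emb
    (MeasurableEquiv.subLeft x).measurableEmbedding f (Iio (x - ε))
  simpa using hmp

theorem setIntegral_lt_abs_sub_eq (hf : IntegrableOn f {y : ℝ | ε < |x - y|}) (hε : 0 < ε) :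
    ∫ y in {y : ℝ | ε < |x - y|}, f y = ∫ z in Ioi ε, (f (x + z) + f (x - z)) := by
  rw [setOf_lt_abs_sub_eq_union] at hf ⊢
  have hright := hf.mono_set subset_union_left
  have hleft := hf.mono_set subset_union_right
  have hdisj : Disjoint (Ioi (x + ε)) (Iio (x - ε)) :=
    Set.disjoint_left.2 fun y hy hy' => by linarith [mem_Ioi.1 hy, mem_Iio.1 hy']
  rw [setIntegral_union hdisj measurableSet_Iio hright hleft,
    integral_add (integrableOn_Ioi_comp_add_left hright) (integrableOn_Ioi_comp_sub_left hleft),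
    setIntegral_Ioi_comp_add_left, setIntegral_Ioi_comp_sub_left]

end Fold

theorem HasHalfLaplacianAt.hasSecondDifferenceIntegral {φ : ℝ → ℝ} {L x : ℝ}
    (hL : HasHalfLaplacianAt φ L x) (hφ : MemLHalf φ) :
    HasSecondDifferenceIntegral φ (π * L) x := by
  have hfold : ∀ z : ℝ, secondDifference φ x z / z ^ 2 =
      (φ x - φ (x + z)) / |x - (x + z)| ^ 2 + (φ x - φ (x - z)) / |x - (x - z)| ^ 2 := by
    intro z
    rw [secondDifference, sq_abs, sq_abs]
    ring_nf
  refine ⟨fun ε hε => ?_, (hL.const_mul π).congr' ?_⟩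
  · have htail := hφ.integrableOn_sub_div_sq x hε
    rw [setOf_lt_abs_sub_eq_union] at htail
    simp only [hfold]
    exact (integrableOn_Ioi_comp_add_left (htail.mono_set subset_union_left)).add
      (integrableOn_Ioi_comp_sub_left (htail.mono_set subset_union_right))
  · filter_upwards [self_mem_nhdsWithin] with ε hε
    simp only [hfold]
    rw [← setIntegral_lt_abs_sub_eq (hφ.integrableOn_sub_div_sq x hε) hε]
    field_simp

theorem tendsto_setIntegral_Ioi_zero {h : ℝ → ℝ} (hh : IntegrableOn h (Ioi 0)) :
    Tendsto (fun ε : ℝ => ∫ z in Ioi ε, h z) (𝓝[>] 0) (𝓝 (∫ z in Ioi 0, h z)) := by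
  have hid : Tendsto (fun ε : ℝ => ε) (𝓝[>] 0) (𝓝 0) := tendsto_id.mono_left nhdsWithin_le_nhds
  refine ((aecover_Ioi_of_Ioi (μ := volume) hid).integral_tendsto_of_countably_generated
    hh).congr' ?_
  filter_upwards [self_mem_nhdsWithin] with ε hε
  rw [Measure.restrict_restrict measurableSet_Ioi, Ioi_inter_Ioi, max_eq_left (mem_Ioi.1 hε).le]

namespace HasSecondDifferenceIntegral

variable {φ ψ : ℝ → ℝ} {ℓ ℓ' x : ℝ}

theorem of_integrableOn (h : IntegrableOn (fun z => secondDifference φ x z / z ^ 2) (Ioi 0)) :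
    HasSecondDifferenceIntegral φ (∫ z in Ioi 0, secondDifference φ x z / z ^ 2) x :=
  ⟨fun _ hε => h.mono_set (Ioi_subset_Ioi hε.le), tendsto_setIntegral_Ioi_zero h⟩

theorem congr_secondDifference (hφ : HasSecondDifferenceIntegral φ ℓ x) {y : ℝ}
    (h : ∀ z, secondDifference ψ y z = secondDifference φ x z) :
    HasSecondDifferenceIntegral ψ ℓ y :=
  ⟨fun ε hε => by simpa only [h] using hφ.integrableOn hε, by simpa only [h] using hφ.tendsto⟩

theorem comp_add_left {c : ℝ} (hφ : HasSecondDifferenceIntegral φ ℓ (c + x)) :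
    HasSecondDifferenceIntegral (fun s => φ (c + s)) ℓ x :=
  hφ.congr_secondDifference fun z => by simp only [secondDifference, add_assoc, add_sub_assoc]

theorem add_linear (hφ : HasSecondDifferenceIntegral φ ℓ x) (κ : ℝ) :
    HasSecondDifferenceIntegral (fun s => φ s + κ * s) ℓ x :=
  hφ.congr_secondDifference fun z => by simp only [secondDifference]; ring

theorem const (c x : ℝ) : HasSecondDifferenceIntegral (fun _ => c) 0 x := by
  have hz : ∀ z, secondDifference (fun _ => c) x z = 0 := fun z => by
    simp only [secondDifference]; ring
  exact ⟨fun ε _ => by simp [hz], by simp [hz]⟩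

theorem add (hφ : HasSecondDifferenceIntegral φ ℓ x) (hψ : HasSecondDifferenceIntegral ψ ℓ' x) :
    HasSecondDifferenceIntegral (fun s => φ s + ψ s) (ℓ + ℓ') x := by
  have hadd : ∀ z, secondDifference (fun s => φ s + ψ s) x z / z ^ 2 =
      secondDifference φ x z / z ^ 2 + secondDifference ψ x z / z ^ 2 := fun z => by
    simp only [secondDifference]; ring
  refine ⟨fun ε hε => ?_, (hφ.tendsto.add hψ.tendsto).congr' ?_⟩
  · simp only [hadd]
    exact (hφ.integrableOn hε).add (hψ.integrableOn hε)
  · filter_upwards [self_mem_nhdsWithin] with ε hε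
    simp only [hadd]
    exact (integral_add (hφ.integrableOn hε) (hψ.integrableOn hε)).symm

theorem const_mul (hφ : HasSecondDifferenceIntegral φ ℓ x) (c : ℝ) :
    HasSecondDifferenceIntegral (fun s => c * φ s) (c * ℓ) x := by
  have hmul : ∀ z, secondDifference (fun s => c * φ s) x z / z ^ 2 =
      c * (secondDifference φ x z / z ^ 2) := fun z => by
    simp only [secondDifference]; ring
  refine ⟨fun ε hε => ?_, (hφ.tendsto.const_mul c).congr fun ε => ?_⟩
  · simp only [hmul]
    exact (hφ.integrableOn hε).const_mul c
  · simp only [hmul, integral_const_mul]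

theorem mono (hφ : HasSecondDifferenceIntegral φ ℓ x) (hψ : HasSecondDifferenceIntegral ψ ℓ' x)
    (hle : ∀ z, 0 < z → secondDifference φ x z ≤ secondDifference ψ x z) : ℓ ≤ ℓ' := by
  refine le_of_tendsto_of_tendsto hφ.tendsto hψ.tendsto ?_
  filter_upwards [self_mem_nhdsWithin] with ε hε
  refine setIntegral_mono_on (hφ.integrableOn hε) (hψ.integrableOn hε) measurableSet_Ioi
    fun z hz => ?_
  gcongr
  exact hle z (lt_trans hε hz)

end HasSecondDifferenceIntegral

section OddMaximumPrinciple

/-- The kernel `|a - s|⁻² - |a + s|⁻²` through which the half-Laplacian at `a` acts on the values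
of an odd function on `(0, ∞)`. -/
noncomputable def oddKernel (a s : ℝ) : ℝ :=
  1 / (a - s) ^ 2 - 1 / (a + s) ^ 2

variable {f : ℝ → ℝ} {a : ℝ}

theorem oddKernel_pos {s : ℝ} (ha : 0 < a) (hs : 0 < s) (has : s ≠ a) : 0 < oddKernel a s := by
  have : a - s ≠ 0 := sub_ne_zero.2 has.symm
  refine sub_pos.2 (one_div_lt_one_div_of_lt (by positivity) ?_)
  nlinarith [mul_pos ha hs]

theorem continuousOn_div_sub_sq (hf : Continuous f) {S : Set ℝ} (hS : a ∉ S) :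
    ContinuousOn (fun s => f s / (a - s) ^ 2) S :=
  hf.continuousOn.div (by fun_prop) fun s hs =>
    pow_ne_zero 2 (sub_ne_zero.2 fun h => hS (h ▸ hs))

theorem continuousOn_div_add_sq (hf : Continuous f) (ha : 0 < a) :
    ContinuousOn (fun s => f s / (a + s) ^ 2) (Ici 0) :=
  hf.continuousOn.div (by fun_prop) fun s hs =>
    pow_ne_zero 2 (by linarith [mem_Ici.1 hs] : 0 < a + s).ne'

theorem continuousOn_mul_oddKernel (hf : Continuous f) (ha : 0 < a) {S : Set ℝ} (hS : a ∉ S)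
    (hS₀ : S ⊆ Ici 0) : ContinuousOn (fun s => f s * oddKernel a s) S := by
  simp only [oddKernel, mul_sub, mul_one_div]
  exact (continuousOn_div_sub_sq hf hS).sub ((continuousOn_div_add_sq hf ha).mono hS₀)

theorem integral_const_div_sq {p q : ℝ} (hp : 0 < p) (hpq : p ≤ q) (c : ℝ) :
    ∫ z in p..q, c / z ^ 2 = c * (1 / p - 1 / q) := by
  have hzero : (0 : ℝ) ∉ uIcc p q := by
    rw [uIcc_of_le hpq]
    exact fun h => hp.not_ge h.1
  have := integral_zpow (a := p) (b := q) (n := -2) (Or.inr ⟨by norm_num, hzero⟩)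
  simp only [div_eq_mul_inv, intervalIntegral.integral_const_mul, ← zpow_natCast, ← zpow_neg]
  push_cast
  rw [this]
  congr 1
  norm_num [zpow_neg]
  ring

theorem intervalIntegrable_div_sq (hf : Continuous f) {p q : ℝ} (hp : 0 < p) (hq : 0 < q) :
    IntervalIntegrable (fun z => f z / z ^ 2) volume p q :=
  (hf.continuousOn.div (by fun_prop) fun z hz =>
    pow_ne_zero 2 ((lt_min hp hq).trans_le hz.1).ne').intervalIntegrable

theorem intervalIntegral_secondDifference_eq_of_odd (hodd : f.Odd) (hf : Continuous f) {ε Z : ℝ}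
    (hε : 0 < ε) (ha : 0 < a) (hZ : 0 < Z) :
    ∫ z in ε..Z, secondDifference f a z / z ^ 2 =
      (∫ z in a..Z, 2 * f a / z ^ 2) + (∫ z in a..Z, (f (z - a) - f a) / z ^ 2) -
        (∫ z in ε..a, (f (a - z) - f a) / z ^ 2) - ∫ z in ε..Z, (f (a + z) - f a) / z ^ 2 := by
  have hsplit : ∫ z in ε..Z, secondDifference f a z / z ^ 2 =
      (∫ z in ε..a, (f a - f (a - z)) / z ^ 2) + (∫ z in a..Z, (f a - f (a - z)) / z ^ 2) -
        ∫ z in ε..Z, (f (a + z) - f a) / z ^ 2 := by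
    rw [intervalIntegral.integral_add_adjacent_intervals
      (intervalIntegrable_div_sq (by fun_prop) hε ha)
      (intervalIntegrable_div_sq (by fun_prop) ha hZ),
      ← intervalIntegral.integral_sub (intervalIntegrable_div_sq (by fun_prop) hε hZ)
      (intervalIntegrable_div_sq (by fun_prop) hε hZ)]
    refine intervalIntegral.integral_congr fun z _ => ?_
    simp only [secondDifference]
    ring
  have hfar : ∫ z in a..Z, (f a - f (a - z)) / z ^ 2 =
      (∫ z in a..Z, 2 * f a / z ^ 2) + ∫ z in a..Z, (f (z - a) - f a) / z ^ 2 := by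
    rw [← intervalIntegral.integral_add (intervalIntegrable_div_sq (by fun_prop) ha hZ)
      (intervalIntegrable_div_sq (by fun_prop) ha hZ)]
    refine intervalIntegral.integral_congr fun z _ => ?_
    simp only [← neg_sub z a, hodd (z - a)]
    ring
  have hnear : ∫ z in ε..a, (f a - f (a - z)) / z ^ 2 =
      -∫ z in ε..a, (f (a - z) - f a) / z ^ 2 := by
    rw [← intervalIntegral.integral_neg]
    exact intervalIntegral.integral_congr fun z _ => by ring
  rw [hsplit, hfar, hnear]
  ring

theorem intervalIntegral_secondDifference_of_odd (hodd : f.Odd) (hf : Continuous f) {ε Z : ℝ}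
    (hε : 0 < ε) (ha : 0 < a) (haZ : a ≤ Z) :
    ∫ z in ε..Z, secondDifference f a z / z ^ 2 = 2 * f a * (1 / a - 1 / Z) +
      (∫ s in 0..Z - a, (f s - f a) / (a + s) ^ 2) - (∫ s in 0..a - ε, (f s - f a) / (a - s) ^ 2) -
      ∫ s in a + ε..a + Z, (f s - f a) / (a - s) ^ 2 := by
  have hright : ∫ s in a + ε..a + Z, (f s - f a) / (a - s) ^ 2 =
      ∫ z in ε..Z, (f (a + z) - f a) / z ^ 2 := by
    have hshift := (intervalIntegral.integral_comp_add_left (a := ε) (b := Z)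
      (fun s => (f s - f a) / (a - s) ^ 2) a).symm
    simpa only [sub_add_cancel_left, neg_sq] using hshift
  have hleft : ∫ s in 0..a - ε, (f s - f a) / (a - s) ^ 2 =
      ∫ z in ε..a, (f (a - z) - f a) / z ^ 2 := by
    simpa using (intervalIntegral.integral_comp_sub_left (a := ε) (b := a)
      (fun s => (f s - f a) / (a - s) ^ 2) a).symm
  have hreflected : ∫ s in 0..Z - a, (f s - f a) / (a + s) ^ 2 =
      ∫ z in a..Z, (f (z - a) - f a) / z ^ 2 := by
    simpa using (intervalIntegral.integral_comp_sub_right (a := a) (b := Z)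
      (fun s => (f s - f a) / (a + s) ^ 2) a).symm
  rw [intervalIntegral_secondDifference_eq_of_odd hodd hf hε ha (ha.trans_le haZ),
    integral_const_div_sq ha haZ, hright, hleft, hreflected]

theorem intervalIntegrable_div_add_sq (hf : Continuous f) (ha : 0 < a) {p q : ℝ} (hp : 0 ≤ p)
    (hq : 0 ≤ q) : IntervalIntegrable (fun s => f s / (a + s) ^ 2) volume p q :=
  ((continuousOn_div_add_sq hf ha).mono fun _ hs => (le_min hp hq).trans hs.1).intervalIntegrable

theorem intervalIntegral_div_add_sq_le (hf : Continuous f) (hnonneg : ∀ s, 0 < s → 0 ≤ f s)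
    {ε Z : ℝ} (hε : 0 < ε) (hεa : ε < a) (haZ : a < Z) :
    ∫ s in 0..Z - a, f s / (a + s) ^ 2 ≤ (∫ s in 0..a - ε, f s / (a + s) ^ 2) +
      (∫ s in a - ε..a + ε, f s / (a + s) ^ 2) + ∫ s in a + ε..a + Z, f s / (a + s) ^ 2 := by
  have hint {p q : ℝ} (hp : 0 ≤ p) (hq : 0 ≤ q) :
      IntervalIntegrable (fun s => f s / (a + s) ^ 2) volume p q :=
    intervalIntegrable_div_add_sq hf (hε.trans hεa) hp hq
  have hextend : ∫ s in 0..Z - a, f s / (a + s) ^ 2 ≤ ∫ s in 0..a + Z, f s / (a + s) ^ 2 := by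
    refine intervalIntegral.integral_mono_interval le_rfl (by linarith) (by linarith) ?_
      (hint le_rfl (by linarith))
    refine (ae_restrict_iff' measurableSet_Ioc).2 (Eventually.of_forall fun s hs => ?_)
    exact div_nonneg (hnonneg s hs.1) (sq_nonneg _)
  refine hextend.trans_eq ?_
  rw [intervalIntegral.integral_add_adjacent_intervals,
    intervalIntegral.integral_add_adjacent_intervals] <;>
  exact hint (by linarith) (by linarith)

theorem intervalIntegral_le_of_odd_of_isMin (hodd : f.Odd) (hf : Continuous f)
    (hmin : ∀ s, 0 < s → f a ≤ f s) {ε Z : ℝ} (hε : 0 < ε) (hεa : ε < a) (haZ : a < Z) :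
    ∫ z in ε..Z, secondDifference f a z / z ^ 2 ≤ 2 * f a * (1 / a - 1 / Z) +
      (∫ s in a - ε..a + ε, (f s - f a) / (a + s) ^ 2) -
      (∫ s in 0..a - ε, (f s - f a) * oddKernel a s) -
      ∫ s in a + ε..a + Z, (f s - f a) * oddKernel a s := by
  have ha : 0 < a := hε.trans hεa
  have hg : Continuous fun s => f s - f a := by fun_prop
  have hadd {p q : ℝ} (hp : 0 ≤ p) (hq : 0 ≤ q) :
      IntervalIntegrable (fun s => (f s - f a) / (a + s) ^ 2) volume p q :=
    intervalIntegrable_div_add_sq hg ha hp hq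
  have hsub {p q : ℝ} (h : a ∉ uIcc p q) :
      IntervalIntegrable (fun s => (f s - f a) / (a - s) ^ 2) volume p q :=
    (continuousOn_div_sub_sq hg h).intervalIntegrable
  have hleft : a ∉ uIcc 0 (a - ε) := by
    rw [uIcc_of_le (by linarith)]
    exact fun h => by linarith [h.2]
  have hright : a ∉ uIcc (a + ε) (a + Z) := by
    rw [uIcc_of_le (by linarith)]
    exact fun h => by linarith [h.1]
  have hreflected := intervalIntegral_div_add_sq_le hg (fun s hs => sub_nonneg.2 (hmin s hs))
    hε hεa haZ
  rw [intervalIntegral_secondDifference_of_odd hodd hf hε ha haZ.le]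
  simp only [oddKernel, mul_sub, mul_one_div]
  rw [intervalIntegral.integral_sub (hsub hleft) (hadd le_rfl (by linarith)),
    intervalIntegral.integral_sub (hsub hright) (hadd (by linarith) (by linarith))]
  linarith

theorem tendsto_intervalIntegral_shrink {q : ℝ → ℝ} {b c : ℝ}
    (hq : IntervalIntegrable q volume b c) (ha : a ∈ Ioo b c) :
    Tendsto (fun ε : ℝ => ∫ s in a - ε..a + ε, q s) (𝓝[>] 0) (𝓝 0) := by
  have hmem : uIcc b c ∈ 𝓝 a := by
    rw [uIcc_of_le (ha.1.trans ha.2).le]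
    exact Icc_mem_nhds ha.1 ha.2
  have hprim : ContinuousAt (fun t => ∫ s in a..t, q s) a :=
    (intervalIntegral.continuousOn_primitive_interval' hq (mem_of_mem_nhds hmem)).continuousAt hmem
  have hplus : Tendsto (fun ε : ℝ => a + ε) (𝓝[>] 0) (𝓝 a) :=
    tendsto_nhdsWithin_of_tendsto_nhds (by simpa using (continuous_const_add a).tendsto 0)
  have hminus : Tendsto (fun ε : ℝ => a - ε) (𝓝[>] 0) (𝓝 a) :=
    tendsto_nhdsWithin_of_tendsto_nhds (by simpa using (continuous_sub_left a).tendsto 0)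
  have hdiff := (hprim.tendsto.comp hplus).sub (hprim.tendsto.comp hminus)
  rw [sub_self] at hdiff
  refine hdiff.congr' ?_
  filter_upwards [hplus hmem, hminus hmem] with ε hp hm
  exact intervalIntegral.integral_interval_sub_left
    (hq.mono_set (uIcc_subset_uIcc (mem_of_mem_nhds hmem) hp))
    (hq.mono_set (uIcc_subset_uIcc (mem_of_mem_nhds hmem) hm))

theorem intervalIntegral_mul_oddKernel_mono (hf : Continuous f) (hnonneg : ∀ s, 0 < s → 0 ≤ f s)
    (ha : 0 < a) {b c p q : ℝ} (hb : 0 ≤ b) (habc : a ∉ Icc b c) (hbp : b ≤ p) (hpq : p ≤ q)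
    (hqc : q ≤ c) : ∫ s in p..q, f s * oddKernel a s ≤ ∫ s in b..c, f s * oddKernel a s := by
  refine intervalIntegral.integral_mono_interval hbp hpq hqc ?_ ?_
  · refine (ae_restrict_iff' measurableSet_Ioc).2 (Eventually.of_forall fun s hs => ?_)
    have hs₀ : 0 < s := hb.trans_lt hs.1
    exact mul_nonneg (hnonneg s hs₀)
      (oddKernel_pos ha hs₀ fun h => habc (h ▸ Ioc_subset_Icc_self hs)).le
  · refine ContinuousOn.intervalIntegrable ?_
    rw [uIcc_of_le (hbp.trans (hpq.trans hqc))]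
    exact continuousOn_mul_oddKernel hf ha habc fun s hs => hb.trans hs.1

theorem intervalIntegral_mul_oddKernel_nonneg (hf : Continuous f)
    (hnonneg : ∀ s, 0 < s → 0 ≤ f s) (ha : 0 < a) {b c : ℝ} (hb : 0 ≤ b) (hbc : b ≤ c)
    (habc : a ∉ Icc b c) : 0 ≤ ∫ s in b..c, f s * oddKernel a s := by
  simpa using intervalIntegral_mul_oddKernel_mono hf hnonneg ha hb habc le_rfl le_rfl hbc

theorem intervalIntegral_mul_oddKernel_le_add (hf : Continuous f)
    (hnonneg : ∀ s, 0 < s → 0 ≤ f s) {p q ε Z : ℝ} (hp : 0 < p) (hpq : p ≤ q) (hε : 0 < ε)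
    (hεa : ε < a) (hεZ : ε ≤ Z) (hsep : q ≤ a - ε ∨ a + ε ≤ p ∧ q ≤ a + Z) :
    ∫ s in p..q, f s * oddKernel a s ≤
      (∫ s in 0..a - ε, f s * oddKernel a s) + ∫ s in a + ε..a + Z, f s * oddKernel a s := by
  have ha : 0 < a := hε.trans hεa
  have hleft : a ∉ Icc 0 (a - ε) := fun h => by linarith [h.2]
  have hright : a ∉ Icc (a + ε) (a + Z) := fun h => by linarith [h.1]
  rcases hsep with hq | ⟨hp', hq⟩
  · exact le_add_of_le_of_nonneg
      (intervalIntegral_mul_oddKernel_mono hf hnonneg ha le_rfl hleft hp.le hpq hq)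
      (intervalIntegral_mul_oddKernel_nonneg hf hnonneg ha (by linarith) (by linarith) hright)
  · exact le_add_of_nonneg_of_le
      (intervalIntegral_mul_oddKernel_nonneg hf hnonneg ha le_rfl (by linarith) hleft)
      (intervalIntegral_mul_oddKernel_mono hf hnonneg ha (by linarith) hright hp' hpq hq)

theorem HasSecondDifferenceIntegral.le_of_odd_of_isMin {ℓ : ℝ}
    (h : HasSecondDifferenceIntegral f ℓ a) (hodd : f.Odd) (hf : Continuous f) (ha : 0 < a)
    (hmin : ∀ s, 0 < s → f a ≤ f s) {p q : ℝ} (hp : 0 < p) (hpq : p ≤ q) (hapq : a ∉ Icc p q) :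
    ℓ ≤ 2 * f a / a - ∫ s in p..q, (f s - f a) * oddKernel a s := by
  set J := ∫ s in p..q, (f s - f a) * oddKernel a s
  have hg : Continuous fun s => f s - f a := by fun_prop
  have hint : IntervalIntegrable (fun s => (f s - f a) / (a + s) ^ 2) volume 0 (2 * a) :=
    intervalIntegrable_div_add_sq hg ha le_rfl (by linarith)
  have hε := ((tendsto_intervalIntegral_shrink hint ⟨ha, by linarith⟩).const_add
    (2 * f a / a)).sub_const J
  rw [add_zero] at hε
  have hgap : ∀ᶠ ε in 𝓝[>] (0 : ℝ), q ≤ a - ε ∨ a + ε ≤ p := by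
    rcases not_and_or.1 hapq with h | h
    · filter_upwards [Ioo_mem_nhdsGT (sub_pos.2 (not_le.1 h))] with ε hε
      exact Or.inr (by linarith [hε.2])
    · filter_upwards [Ioo_mem_nhdsGT (sub_pos.2 (not_le.1 h))] with ε hε
      exact Or.inl (by linarith [hε.2])
  refine le_of_tendsto_of_tendsto h.tendsto hε ?_
  filter_upwards [hgap, Ioo_mem_nhdsGT ha] with ε hsep ⟨hε, hεa⟩
  have hZ : Tendsto (fun Z : ℝ => 2 * f a * (1 / a - 1 / Z) +
      (∫ s in a - ε..a + ε, (f s - f a) / (a + s) ^ 2) - J) atTop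
      (𝓝 (2 * f a * (1 / a - 0) + (∫ s in a - ε..a + ε, (f s - f a) / (a + s) ^ 2) - J)) := by
    simp only [one_div]
    exact ((((tendsto_inv_atTop_zero).const_sub _).const_mul _).add_const _).sub_const _
  rw [sub_zero, mul_one_div] at hZ
  refine le_of_tendsto_of_tendsto
    (intervalIntegral_tendsto_integral_Ioi ε (h.integrableOn hε) tendsto_id) hZ ?_
  filter_upwards [eventually_gt_atTop a, eventually_ge_atTop (q - a)] with Z haZ hqZ
  have htrunc := intervalIntegral_le_of_odd_of_isMin hodd hf hmin hε hεa haZ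
  have hJ := intervalIntegral_mul_oddKernel_le_add hg (fun s hs => sub_nonneg.2 (hmin s hs)) hp hpq
    hε hεa (hεa.trans haZ).le (hsep.imp_right fun h => ⟨h, by linarith⟩)
  simp only [id_eq]
  linarith

theorem HasSecondDifferenceIntegral.le_two_mul_div_of_odd_of_isMin {ℓ : ℝ}
    (h : HasSecondDifferenceIntegral f ℓ a) (hodd : f.Odd) (hf : Continuous f) (ha : 0 < a)
    (hmin : ∀ s, 0 < s → f a ≤ f s) : ℓ ≤ 2 * f a / a := by
  simpa using h.le_of_odd_of_isMin hodd hf ha hmin (p := a + 1) (q := a + 1) (by linarith) le_rfl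
    fun h => by linarith [h.1]

theorem HasSecondDifferenceIntegral.neg_of_odd_of_nonneg {ℓ b : ℝ}
    (h : HasSecondDifferenceIntegral f ℓ a) (hodd : f.Odd) (hf : Continuous f) (ha : 0 < a)
    (hfa : f a = 0) (hnonneg : ∀ s, 0 < s → 0 ≤ f s) (hb : 0 < b) (hfb : 0 < f b) : ℓ < 0 := by
  have hab : a ≠ b := fun hab => by simp [← hab, hfa] at hfb
  obtain ⟨p, q, hp, hpq, hapq, hbpq⟩ :
      ∃ p q, 0 < p ∧ p < q ∧ a ∉ Icc p q ∧ b ∈ Icc p q := by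
    rcases hab.lt_or_gt with h | h
    · exact ⟨b, b + 1, hb, by linarith, fun h' => h.not_ge h'.1, le_rfl, by linarith⟩
    · exact ⟨b / 2, b, by linarith, by linarith, fun h' => h.not_ge h'.2, by linarith, le_rfl⟩
  have hle := h.le_of_odd_of_isMin hodd hf ha (fun s hs => hfa ▸ hnonneg s hs) hp hpq.le hapq
  have hpos : ∀ s ∈ Icc p q, 0 < oddKernel a s := fun s hs =>
    oddKernel_pos ha (hp.trans_le hs.1) fun h => hapq (h ▸ hs)
  have hint : 0 < ∫ s in p..q, f s * oddKernel a s :=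
    intervalIntegral.integral_pos hpq
      (continuousOn_mul_oddKernel hf ha hapq fun s hs => hp.le.trans hs.1)
      (fun s hs => mul_nonneg (hnonneg s (hp.trans hs.1)) (hpos s (Ioc_subset_Icc_self hs)).le)
      ⟨b, hbpq, mul_pos hfb (hpos b hbpq)⟩
  simp only [hfa, sub_zero, mul_zero, zero_div, zero_sub] at hle
  linarith

end OddMaximumPrinciple

theorem exists_isMinOn_Ioi_zero {f : ℝ → ℝ} (hf : Continuous f) (hf0 : f 0 = 0) {s₀ : ℝ}
    (hs₀ : 0 < s₀) (hneg : f s₀ < 0) (hev : ∀ᶠ s in atTop, f s₀ ≤ f s) :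
    ∃ a, 0 < a ∧ f a ≤ f s₀ ∧ ∀ s, 0 < s → f a ≤ f s := by
  obtain ⟨T, hT⟩ := eventually_atTop.1 hev
  have hs₀mem : s₀ ∈ Icc 0 (max T s₀) := ⟨hs₀.le, le_max_right _ _⟩
  obtain ⟨a, ha, hmin⟩ := isCompact_Icc.exists_isMinOn ⟨s₀, hs₀mem⟩ hf.continuousOn
  have hle : f a ≤ f s₀ := hmin hs₀mem
  have ha0 : 0 ≠ a := fun h => by rw [← h, hf0] at hle; linarith
  refine ⟨a, lt_of_le_of_ne ha.1 ha0, hle, fun s hs => ?_⟩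
  rcases le_total s (max T s₀) with h | h
  · exact hmin (⟨hs.le, h⟩ : s ∈ Icc 0 (max T s₀))
  · exact hle.trans (hT s ((le_max_left _ _).trans h))

/- A Phragmén–Lindelöf principle: adding `κ s` with small `κ > 0` produces a negative minimum and
does not change the second differences. -/
theorem neg_le_of_odd_of_sublinear {f : ℝ → ℝ} (hodd : f.Odd) (hf : Continuous f)
    (hgrowth : ∀ δ, 0 < δ → ∀ᶠ s in atTop, -(δ * s) ≤ f s) {B : ℝ} (hB : 0 ≤ B)
    (hsuper : ∀ a, 0 < a → ∃ ℓ, HasSecondDifferenceIntegral f ℓ a ∧ -(2 * B / a) ≤ ℓ)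
    {s : ℝ} (hs : 0 < s) : -B ≤ f s := by
  by_contra! hlt
  obtain ⟨κ, hκ, hκs⟩ : ∃ κ, 0 < κ ∧ f s + κ * s < -B :=
    ⟨(-B - f s) / (2 * s), by apply div_pos <;> linarith, by field_simp; linarith⟩
  have hodd' : (fun s => f s + κ * s).Odd := fun s => by simp only [hodd s]; ring
  obtain ⟨a, ha, has, hmin⟩ := exists_isMinOn_Ioi_zero (f := fun s => f s + κ * s) (by fun_prop)
    hodd'.map_zero hs (by linarith) (by
      filter_upwards [hgrowth κ hκ] with t ht
      linarith)
  obtain ⟨ℓ, hℓ, hle⟩ := hsuper a ha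
  have hmax := (hℓ.add_linear κ).le_two_mul_div_of_odd_of_isMin hodd' (by fun_prop) ha hmin
  have : 2 * (f a + κ * a) / a < -(2 * B / a) := by
    rw [← neg_div]
    gcongr
    linarith
  linarith

/-- The Lorentzian profile `(ρ² + x²)⁻¹`, a multiple of the Poisson kernel of the half-plane at
height `ρ`; it is the building block of the barriers. -/
noncomputable def lorentzian (ρ x : ℝ) : ℝ :=
  (ρ ^ 2 + x ^ 2)⁻¹

section Lorentzian

variable {ρ : ℝ}

theorem lorentzian_pos (hρ : 0 < ρ) (x : ℝ) : 0 < lorentzian ρ x := by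
  unfold lorentzian
  positivity

theorem continuous_lorentzian (hρ : 0 < ρ) : Continuous (lorentzian ρ) :=
  Continuous.inv₀ (by fun_prop) fun x => by positivity

theorem sq_mul_lorentzian_le_one (hρ : 0 < ρ) (x : ℝ) : ρ ^ 2 * lorentzian ρ x ≤ 1 := by
  rw [lorentzian, ← div_eq_mul_inv, div_le_one (by positivity)]
  nlinarith [sq_nonneg x]

theorem tendsto_lorentzian_cocompact (ρ : ℝ) : Tendsto (lorentzian ρ) (cocompact ℝ) (𝓝 0) := by
  refine tendsto_inv_atTop_zero.comp (tendsto_atTop_add_const_left _ _ ?_)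
  exact ((tendsto_pow_atTop two_ne_zero).comp tendsto_norm_cocompact_atTop).congr fun x => sq_abs x

theorem tendsto_lorentzian_atTop (x : ℝ) : Tendsto (fun ρ => lorentzian ρ x) atTop (𝓝 0) :=
  tendsto_inv_atTop_zero.comp (tendsto_atTop_add_const_right _ _ (tendsto_pow_atTop two_ne_zero))

theorem lorentzian_eq_mul_comp_div (hρ : 0 < ρ) (x : ℝ) :
    lorentzian ρ x = (ρ ^ 2)⁻¹ * (1 + (x / ρ) ^ 2)⁻¹ := by
  rw [lorentzian]
  field_simp

theorem integrable_lorentzian (hρ : 0 < ρ) : Integrable (lorentzian ρ) := by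
  rw [funext (lorentzian_eq_mul_comp_div hρ)]
  exact (integrable_inv_one_add_sq.comp_div hρ.ne').const_mul _

theorem integral_lorentzian (hρ : 0 < ρ) : ∫ x, lorentzian ρ x = π / ρ := by
  simp only [lorentzian_eq_mul_comp_div hρ]
  rw [integral_const_mul, Measure.integral_comp_div (fun t : ℝ => (1 + t ^ 2)⁻¹) ρ,
    integral_univ_inv_one_add_sq, abs_of_pos hρ, smul_eq_mul]
  field_simp

theorem abs_secondDifference_lorentzian_le (hρ : 0 < ρ) (x : ℝ) {z : ℝ} (hz : 0 < z) :
    |secondDifference (lorentzian ρ) x z / z ^ 2| ≤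
      6 * lorentzian ρ x * lorentzian ρ (|x| - z) := by
  wlog hx : 0 ≤ x generalizing x
  · have := this (-x) (by linarith)
    rw [abs_neg x] at this
    simp only [secondDifference, lorentzian] at this ⊢
    rw [neg_sq, show (-x + z) ^ 2 = (x - z) ^ 2 by ring, show (-x - z) ^ 2 = (x + z) ^ 2 by ring,
      sub_right_comm] at this
    exact this
  have hadd : 0 < ρ ^ 2 + (x + z) ^ 2 := by positivity
  have : 0 < ρ ^ 2 + (x - z) ^ 2 := by positivity
  have hexplicit : secondDifference (lorentzian ρ) x z / z ^ 2 =
      2 * (ρ ^ 2 + z ^ 2 - 3 * x ^ 2) / (ρ ^ 2 + (x + z) ^ 2) *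
        lorentzian ρ x * lorentzian ρ (x - z) := by
    simp only [secondDifference, lorentzian]
    field_simp
    ring
  rw [abs_of_nonneg hx, hexplicit, abs_mul, abs_mul, abs_of_pos (lorentzian_pos hρ x),
    abs_of_pos (lorentzian_pos hρ (x - z))]
  have hlx := (lorentzian_pos hρ x).le
  have hlz := (lorentzian_pos hρ (x - z)).le
  gcongr
  rw [abs_div, abs_of_pos hadd, div_le_iff₀ hadd, abs_le]
  have := mul_nonneg hx hz.le
  constructor <;> nlinarith [sq_nonneg ρ, sq_nonneg x, sq_nonneg z]

theorem exists_hasSecondDifferenceIntegral_lorentzian (hρ : 0 < ρ) (x : ℝ) :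
    ∃ ℓ, HasSecondDifferenceIntegral (lorentzian ρ) ℓ x ∧ |ℓ| ≤ 6 * π / ρ * lorentzian ρ x := by
  have hmaj : Integrable fun z => 6 * lorentzian ρ x * lorentzian ρ (|x| - z) :=
    ((integrable_lorentzian hρ).comp_sub_left |x|).const_mul _
  have hbound : ∀ᵐ z ∂volume.restrict (Ioi 0), ‖secondDifference (lorentzian ρ) x z / z ^ 2‖ ≤
      6 * lorentzian ρ x * lorentzian ρ (|x| - z) :=
    (ae_restrict_iff' measurableSet_Ioi).2 (Eventually.of_forall fun z hz =>
      abs_secondDifference_lorentzian_le hρ x hz)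
  have hmeas : Measurable fun z => secondDifference (lorentzian ρ) x z / z ^ 2 := by
    have := (continuous_lorentzian hρ).measurable
    unfold secondDifference
    fun_prop
  refine ⟨_, .of_integrableOn (hmaj.integrableOn.mono' hmeas.aestronglyMeasurable hbound), ?_⟩
  have hnonneg : 0 ≤ᵐ[volume] fun z => 6 * lorentzian ρ x * lorentzian ρ (|x| - z) :=
    Eventually.of_forall fun z =>
      mul_nonneg (by linarith [lorentzian_pos hρ x]) (lorentzian_pos hρ _).le
  calc |∫ z in Ioi 0, secondDifference (lorentzian ρ) x z / z ^ 2|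
      ≤ ∫ z in Ioi 0, 6 * lorentzian ρ x * lorentzian ρ (|x| - z) :=
        norm_integral_le_of_norm_le hmaj.integrableOn hbound
    _ ≤ ∫ z, 6 * lorentzian ρ x * lorentzian ρ (|x| - z) := setIntegral_le_integral hmaj hnonneg
    _ = 6 * π / ρ * lorentzian ρ x := by
        rw [integral_const_mul, integral_sub_left_eq_self (lorentzian ρ), integral_lorentzian hρ]
        ring

end Lorentzian

theorem le_of_eventually_le_of_secondDifferenceIntegral_lt {u B : ℝ → ℝ} (hu : Continuous u)
    (hB : Continuous B) (hfar : ∀ᶠ x in cocompact ℝ, u x ≤ B x)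
    (hlt : ∀ x, B x < u x → ∃ ℓ ℓ', HasSecondDifferenceIntegral u ℓ x ∧
      HasSecondDifferenceIntegral B ℓ' x ∧ ℓ < ℓ') (y : ℝ) : u y ≤ B y := by
  by_contra! hy
  obtain ⟨x, hx⟩ := (hu.sub hB).exists_forall_ge' y (by
    filter_upwards [hfar] with x hx
    simp only [Pi.sub_apply]
    linarith)
  simp only [Pi.sub_apply] at hx
  obtain ⟨ℓ, ℓ', hℓ, hℓ', h⟩ := hlt x (by linarith [hx y])
  refine h.not_ge (hℓ'.mono hℓ fun z _ => ?_)
  simp only [secondDifference]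
  linarith [hx (x + z), hx (x - z)]

/-- The supersolution of `(-Δ)^{1/2} φ + φ = 0` used as a barrier: it is at least `M` near infinity
and on `[-R, R]`, and tends to a multiple of `lorentzian 6` as `ρ → ∞`. The height `6` is
the one at which the bound `6π/ρ` on the half-Laplacian of `lorentzian ρ`, relative to its value,
becomes `π`. -/
noncomputable def decayBarrier (M R ρ x : ℝ) : ℝ :=
  M * (36 + R ^ 2) * lorentzian 6 x + M * (1 - ρ ^ 2 * lorentzian ρ x + 6 / ρ)

section DecayBarrier

variable {M R ρ : ℝ}

theorem continuous_decayBarrier (hρ : 0 < ρ) : Continuous (decayBarrier M R ρ) := by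
  have h6 := continuous_lorentzian (ρ := 6) (by norm_num)
  have hρ := continuous_lorentzian hρ
  unfold decayBarrier
  fun_prop

theorem exists_hasSecondDifferenceIntegral_decayBarrier (hM : 0 ≤ M) (hρ : 0 < ρ) (x : ℝ) :
    ∃ ℓ, HasSecondDifferenceIntegral (decayBarrier M R ρ) ℓ x ∧
      -(π * decayBarrier M R ρ x) ≤ ℓ := by
  obtain ⟨ℓ₆, h₆, hle₆⟩ := exists_hasSecondDifferenceIntegral_lorentzian (ρ := 6) (by norm_num) x
  obtain ⟨ℓ, h, hle⟩ := exists_hasSecondDifferenceIntegral_lorentzian hρ x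
  refine ⟨_, ((h₆.const_mul (M * (36 + R ^ 2))).add ((h.const_mul (-(M * ρ ^ 2))).add
    (.const (M * (1 + 6 / ρ)) x))).congr_secondDifference fun z => ?_, ?_⟩
  · simp only [secondDifference, decayBarrier]
    ring
  have : 0 ≤ M * (36 + R ^ 2) := by positivity
  have hfirst : -(M * (36 + R ^ 2) * (π * lorentzian 6 x)) ≤ M * (36 + R ^ 2) * ℓ₆ := by
    rw [← mul_neg]
    gcongr
    refine (abs_le.1 (hle₆.trans_eq ?_)).1
    ring
  have hsecond : M * ρ ^ 2 * ℓ ≤ π * (M * (6 / ρ)) :=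
    calc M * ρ ^ 2 * ℓ ≤ M * ρ ^ 2 * (6 * π / ρ * lorentzian ρ x) := by
          gcongr
          exact (abs_le.1 hle).2
      _ = π * (M * (6 / ρ)) * (ρ ^ 2 * lorentzian ρ x) := by ring
      _ ≤ π * (M * (6 / ρ)) :=
          mul_le_of_le_one_right (by positivity) (sq_mul_lorentzian_le_one hρ x)
  have hdeficit : 0 ≤ π * (M * (1 - ρ ^ 2 * lorentzian ρ x)) :=
    mul_nonneg Real.pi_pos.le (mul_nonneg hM (sub_nonneg.2 (sq_mul_lorentzian_le_one hρ x)))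
  unfold decayBarrier
  linarith

theorem eventually_le_decayBarrier (hM : 0 ≤ M) (hρ : 0 < ρ) :
    ∀ᶠ x in cocompact ℝ, M ≤ decayBarrier M R ρ x := by
  have hsmall : ∀ᶠ x in cocompact ℝ, ρ ^ 2 * lorentzian ρ x < 6 / ρ :=
    ((tendsto_lorentzian_cocompact ρ).const_mul (ρ ^ 2)).eventually_lt_const
      (by rw [mul_zero]; positivity)
  filter_upwards [hsmall] with x hx
  have h6 : 0 ≤ M * (36 + R ^ 2) * lorentzian 6 x :=
    mul_nonneg (by positivity) (lorentzian_pos (by norm_num) x).le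
  unfold decayBarrier
  nlinarith

theorem le_decayBarrier_of_abs_le (hM : 0 ≤ M) (hρ : 0 < ρ) {x : ℝ} (hx : |x| ≤ R) :
    M ≤ decayBarrier M R ρ x := by
  have hsq : x ^ 2 ≤ R ^ 2 := sq_le_sq' (abs_le.1 hx).1 (abs_le.1 hx).2
  have hnear : M ≤ M * (36 + R ^ 2) * lorentzian 6 x := by
    rw [lorentzian, ← div_eq_mul_inv, le_div_iff₀ (by positivity)]
    gcongr
    linarith
  have hrest : 0 ≤ M * (1 - ρ ^ 2 * lorentzian ρ x + 6 / ρ) := by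
    have := sq_mul_lorentzian_le_one hρ x
    have : 0 < 6 / ρ := by positivity
    exact mul_nonneg hM (by linarith)
  unfold decayBarrier
  linarith

theorem tendsto_decayBarrier (M R x : ℝ) :
    Tendsto (fun ρ => decayBarrier M R ρ x) atTop (𝓝 (M * (36 + R ^ 2) * lorentzian 6 x)) := by
  have hlim : Tendsto (fun ρ : ℝ => M * (36 + R ^ 2) * lorentzian 6 x +
      M * (x ^ 2 * lorentzian ρ x + 6 * ρ⁻¹)) atTop (𝓝 (M * (36 + R ^ 2) * lorentzian 6 x +
      M * (x ^ 2 * 0 + 6 * 0))) :=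
    ((((tendsto_lorentzian_atTop x).const_mul _).add
      (tendsto_inv_atTop_zero.const_mul 6)).const_mul M).const_add _
  simp only [mul_zero, add_zero] at hlim
  refine hlim.congr' ?_
  filter_upwards [eventually_gt_atTop 0] with ρ hρ
  simp only [decayBarrier, lorentzian]
  field_simp
  ring

end DecayBarrier

theorem exists_le_div_one_add_sq {u : ℝ → ℝ} (hu : Continuous u) {M R : ℝ} (hM : 0 ≤ M)
    (huM : ∀ x, u x ≤ M)
    (hsub : ∀ x, R < |x| → ∃ ℓ, HasSecondDifferenceIntegral u ℓ x ∧ ℓ + π * u x ≤ 0) :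
    ∃ A, ∀ x, u x ≤ A / (1 + x ^ 2) := by
  refine ⟨M * (36 + R ^ 2), fun y => ?_⟩
  have hbarrier : ∀ ρ, 0 < ρ → u y ≤ decayBarrier M R ρ y := fun ρ hρ => by
    refine le_of_eventually_le_of_secondDifferenceIntegral_lt hu (continuous_decayBarrier hρ)
      ((eventually_le_decayBarrier hM hρ).mono fun x hx => (huM x).trans hx) (fun x hx => ?_) y
    have hxR : R < |x| := by
      by_contra! h
      exact hx.not_ge ((huM x).trans (le_decayBarrier_of_abs_le hM hρ h))
    obtain ⟨ℓ, hℓ, hle⟩ := hsub x hxR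
    obtain ⟨ℓ', hℓ', hle'⟩ := exists_hasSecondDifferenceIntegral_decayBarrier (R := R) hM hρ x
    exact ⟨ℓ, ℓ', hℓ, hℓ', by nlinarith [Real.pi_pos]⟩
  have hlim : u y ≤ M * (36 + R ^ 2) * lorentzian 6 y :=
    ge_of_tendsto (tendsto_decayBarrier M R y)
      ((eventually_gt_atTop 0).mono fun ρ hρ => hbarrier ρ hρ)
  refine hlim.trans ?_
  rw [lorentzian, ← div_eq_mul_inv]
  gcongr
  norm_num

theorem one_div_sq_eq_rpow {z : ℝ} (hz : 0 < z) : 1 / z ^ 2 = z ^ (-2 : ℝ) := by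
  rw [Real.rpow_neg hz.le, Real.rpow_two, one_div]

theorem integrableOn_Ioi_one_div_sq {ρ : ℝ} (hρ : 0 < ρ) :
    IntegrableOn (fun z : ℝ => 1 / z ^ 2) (Ioi ρ) :=
  (integrableOn_Ioi_rpow_of_lt (by norm_num) hρ).congr_fun
    (fun _ hz => (one_div_sq_eq_rpow (hρ.trans hz)).symm) measurableSet_Ioi

theorem integral_Ioi_one_div_sq {ρ : ℝ} (hρ : 0 < ρ) : ∫ z in Ioi ρ, 1 / z ^ 2 = 1 / ρ := by
  rw [setIntegral_congr_fun measurableSet_Ioi fun z hz => one_div_sq_eq_rpow (hρ.trans hz),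
    integral_Ioi_rpow_of_lt (by norm_num) hρ]
  norm_num [Real.rpow_neg_one]

namespace HasSecondDifferenceIntegral

variable {v q : ℝ → ℝ} {ℓ x ρ : ℝ}

theorem sub_integral_le_setIntegral_Ioi (h : HasSecondDifferenceIntegral v ℓ x) (hρ : 0 < ρ)
    (hq : Integrable q) (hq₀ : ∀ y, 0 ≤ q y)
    (hfar : ∀ y, ρ < |x - y| → v y / (x - y) ^ 2 ≤ q y) :
    2 * v x / ρ - ∫ y, q y ≤ ∫ z in Ioi ρ, secondDifference v x z / z ^ 2 := by
  have hfold : IntegrableOn (fun z => q (x + z) + q (x - z)) (Ioi ρ) :=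
    ((hq.comp_add_left x).add (hq.comp_sub_left x)).integrableOn
  have hsq := (integrableOn_Ioi_one_div_sq hρ).const_mul (2 * v x)
  have hpointwise : ∀ z ∈ Ioi ρ, 2 * v x * (1 / z ^ 2) - (q (x + z) + q (x - z)) ≤
      secondDifference v x z / z ^ 2 := fun z hz => by
    have hz₀ : 0 < z := hρ.trans hz
    have hright := hfar (x + z) (by simpa [abs_of_pos hz₀] using hz)
    have hleft := hfar (x - z) (by simpa [abs_of_pos hz₀] using hz)
    simp only [sub_add_cancel_left, neg_sq, sub_sub_cancel] at hright hleft
    rw [secondDifference, sub_div, sub_div, mul_one_div]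
    linarith
  calc 2 * v x / ρ - ∫ y, q y ≤ 2 * v x / ρ - ∫ y in {y | ρ < |x - y|}, q y :=
        sub_le_sub_left (setIntegral_le_integral hq (Eventually.of_forall hq₀)) _
    _ = ∫ z in Ioi ρ, (2 * v x * (1 / z ^ 2) - (q (x + z) + q (x - z))) := by
        rw [setIntegral_lt_abs_sub_eq hq.integrableOn hρ, integral_sub hsq hfold,
          integral_const_mul, integral_Ioi_one_div_sq hρ, mul_one_div]
    _ ≤ _ := setIntegral_mono_on (hsq.sub hfold) (h.integrableOn hρ) measurableSet_Ioi hpointwise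

theorem le_of_near_of_far (h : HasSecondDifferenceIntegral v ℓ x) (hρ : 0 < ρ) {k : ℝ}
    (hk : 0 ≤ k) (hnear : ∀ z ∈ Ioc 0 ρ, -(k * z ^ 2) ≤ secondDifference v x z)
    (hq : Integrable q) (hq₀ : ∀ y, 0 ≤ q y)
    (hfar : ∀ y, ρ < |x - y| → v y / (x - y) ^ 2 ≤ q y) :
    2 * v x / ρ - k * ρ - ∫ y, q y ≤ ℓ := by
  refine ge_of_tendsto h.tendsto ?_
  filter_upwards [Ioo_mem_nhdsGT hρ] with ε ⟨hε, hερ⟩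
  have hint : IntegrableOn (fun z => secondDifference v x z / z ^ 2) (Ioc ε ρ) :=
    (h.integrableOn hε).mono_set Ioc_subset_Ioi_self
  have hpointwise : ∀ z ∈ Ioc ε ρ, -k ≤ secondDifference v x z / z ^ 2 := fun z hz => by
    have hz₀ : 0 < z := hε.trans hz.1
    rw [le_div_iff₀ (by positivity), neg_mul]
    exact hnear z ⟨hz₀, hz.2⟩
  have hcore : -(k * ρ) ≤ ∫ z in Ioc ε ρ, secondDifference v x z / z ^ 2 :=
    calc -(k * ρ) ≤ ∫ _ in Ioc ε ρ, -k := by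
          rw [setIntegral_const, Real.volume_real_Ioc_of_le hερ.le, smul_eq_mul]
          nlinarith
      _ ≤ _ := setIntegral_mono_on (by simp) hint measurableSet_Ioc hpointwise
  rw [← Ioc_union_Ioi_eq_Ioi hερ.le, setIntegral_union
    (Set.disjoint_left.2 fun z hz hz' => hz.2.not_gt hz') measurableSet_Ioi hint
    (h.integrableOn hρ)]
  linarith [h.sub_integral_le_setIntegral_Ioi hρ hq hq₀ hfar]

end HasSecondDifferenceIntegral

theorem parabola_secondDifference_le {r s z : ℝ} (hs : |s| < r) (hz : 0 ≤ z)
    (hzr : 8 * z ≤ r - |s|) :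
    (r ^ 2 - s ^ 2) / (r ^ 2 - (s + z) ^ 2) + (r ^ 2 - s ^ 2) / (r ^ 2 - (s - z) ^ 2) - 2 ≤
      40 / (r - |s|) ^ 2 * z ^ 2 := by
  have hgap : 0 < r - |s| := sub_pos.2 hs
  have hr : 0 < r := (abs_nonneg s).trans_lt hs
  have hlower : ∀ t, |t| ≤ |s| + z → (r - |s|) * r / 2 ≤ r ^ 2 - t ^ 2 := fun t ht => by
    rw [← sq_abs t]
    nlinarith [abs_nonneg t, abs_nonneg s]
  have hadd := hlower (s + z) ((abs_add_le s z).trans_eq (by rw [abs_of_nonneg hz]))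
  have hsub := hlower (s - z) ((abs_sub s z).trans_eq (by rw [abs_of_nonneg hz]))
  have hpos : 0 < (r - |s|) * r / 2 := by positivity
  have hadd₀ := hpos.trans_le hadd
  have hsub₀ := hpos.trans_le hsub
  have : s ^ 2 ≤ r ^ 2 := sq_le_sq' (by linarith [neg_abs_le s]) (by linarith [le_abs_self s])
  calc _ = 2 * z ^ 2 * (r ^ 2 + 3 * s ^ 2 - z ^ 2) /
          ((r ^ 2 - (s + z) ^ 2) * (r ^ 2 - (s - z) ^ 2)) := by
        field_simp
        ring
    _ ≤ 2 * z ^ 2 * (5 * r ^ 2) / (((r - |s|) * r / 2) * ((r - |s|) * r / 2)) := by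
        gcongr
        nlinarith [sq_nonneg z]
    _ = 40 / (r - |s|) ^ 2 * z ^ 2 := by
        field_simp
        ring

section InteriorEstimate

variable {v : ℝ → ℝ} {R : ℝ}

/- In place of a mean value formula: at a maximum of `v y * (R ^ 2 - y ^ 2)` the function `v` is
touched from above by a multiple of `(R ^ 2 - y ^ 2)⁻¹`, so the singular part of the second
difference integral is under control on the scale `R - |x|`. -/
theorem exists_isMax_mul_parabola (hv : Continuous v) (hR : 0 < R) (hv₀ : 0 < v 0) :
    ∃ x, |x| < R ∧ 0 < v x ∧ ∀ y, |y| ≤ R → v y * (R ^ 2 - y ^ 2) ≤ v x * (R ^ 2 - x ^ 2) := by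
  obtain ⟨x, hx, hmax⟩ := isCompact_Icc.exists_isMaxOn (nonempty_Icc.2 (by linarith : -R ≤ R))
    (f := fun y => v y * (R ^ 2 - y ^ 2)) (by fun_prop)
  have hmax' : ∀ y, |y| ≤ R → v y * (R ^ 2 - y ^ 2) ≤ v x * (R ^ 2 - x ^ 2) :=
    fun y hy => hmax (abs_le.1 hy)
  have hprod : 0 < v x * (R ^ 2 - x ^ 2) :=
    (mul_pos hv₀ (pow_pos hR 2)).trans_le (by simpa using hmax' 0 (by simpa using hR.le))
  have hx₀ : 0 ≤ R ^ 2 - x ^ 2 := sub_nonneg.2 (sq_le_sq' hx.1 hx.2)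
  have hx₁ : 0 < R ^ 2 - x ^ 2 := hx₀.lt_of_ne fun h => by simp [← h] at hprod
  exact ⟨x, abs_lt_of_sq_lt_sq (sub_pos.1 hx₁) hR.le, pos_of_mul_pos_left hprod hx₀, hmax'⟩

theorem neg_mul_sq_le_secondDifference_of_isMax_mul_parabola {x z : ℝ} (hx : |x| < R)
    (hvx : 0 < v x)
    (hmax : ∀ y, |y| ≤ R → v y * (R ^ 2 - y ^ 2) ≤ v x * (R ^ 2 - x ^ 2)) (hz : 0 ≤ z)
    (hzR : 8 * z ≤ R - |x|) :
    -(40 * v x / (R - |x|) ^ 2 * z ^ 2) ≤ secondDifference v x z := by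
  have htouch : ∀ y, |y| < R → v y ≤ v x * ((R ^ 2 - x ^ 2) / (R ^ 2 - y ^ 2)) := fun y hy => by
    have hpos : 0 < R ^ 2 - y ^ 2 := sub_pos.2 (sq_lt_sq' (abs_lt.1 hy).1 (abs_lt.1 hy).2)
    rw [← mul_div_assoc, le_div_iff₀ hpos]
    exact hmax y hy.le
  have hadd := htouch (x + z) (by linarith [abs_add_le x z, abs_of_nonneg hz])
  have hsub := htouch (x - z) (by linarith [abs_sub x z, abs_of_nonneg hz])
  have hparabola := mul_le_mul_of_nonneg_left (parabola_secondDifference_le hx hz hzR) hvx.le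
  rw [secondDifference, mul_comm 40, mul_div_assoc, mul_assoc]
  linarith

theorem div_sub_sq_le_mul_div_sq_add_sq {x y ρ : ℝ} (hρ : 0 < ρ) (hρx : ρ + |x| ≤ R)
    (hy : ρ < |x - y|) :
    v y / (x - y) ^ 2 ≤ 5 * R ^ 2 / ρ ^ 2 * (|v y| / (R ^ 2 + y ^ 2)) := by
  have hρy : ρ ^ 2 ≤ (x - y) ^ 2 := by
    rw [← sq_abs (x - y)]
    gcongr
  have hρR : ρ ^ 2 ≤ R ^ 2 := by
    gcongr
    linarith [abs_nonneg x]
  have hxR : x ^ 2 ≤ R ^ 2 := sq_le_sq' (by linarith [neg_abs_le x]) (by linarith [le_abs_self x])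
  have hsq : 0 < (x - y) ^ 2 := (pow_pos hρ 2).trans_le hρy
  have hR : 0 < R ^ 2 := (pow_pos hρ 2).trans_le hρR
  have hkernel : ρ ^ 2 * (R ^ 2 + y ^ 2) ≤ 5 * R ^ 2 * (x - y) ^ 2 := by
    nlinarith [sq_nonneg (y - 2 * x), mul_le_mul_of_nonneg_left hρy (sq_nonneg R),
      mul_le_mul_of_nonneg_right hρR hsq.le]
  rw [div_mul_div_comm, div_le_div_iff₀ hsq (by positivity)]
  calc v y * (ρ ^ 2 * (R ^ 2 + y ^ 2)) ≤ |v y| * (ρ ^ 2 * (R ^ 2 + y ^ 2)) := by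
        gcongr
        exact le_abs_self _
    _ ≤ |v y| * (5 * R ^ 2 * (x - y) ^ 2) := by gcongr
    _ = 5 * R ^ 2 * |v y| * (x - y) ^ 2 := by ring

theorem mul_le_integral_of_isMax_mul_parabola {x ℓ : ℝ}
    (hint : Integrable fun y => |v y| / (R ^ 2 + y ^ 2)) (hx : |x| < R) (hvx : 0 < v x)
    (hmax : ∀ y, |y| ≤ R → v y * (R ^ 2 - y ^ 2) ≤ v x * (R ^ 2 - x ^ 2))
    (hℓ : HasSecondDifferenceIntegral v ℓ x) (hℓ₀ : ℓ ≤ 0) :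
    v x * (R - |x|) ≤ 32 * R ^ 2 * ∫ y, |v y| / (R ^ 2 + y ^ 2) := by
  set T := ∫ y, |v y| / (R ^ 2 + y ^ 2)
  have hT : 0 ≤ T := integral_nonneg fun y => by positivity
  obtain ⟨ρ, hρ⟩ : ∃ ρ, R - |x| = 8 * ρ := ⟨(R - |x|) / 8, by ring⟩
  have hρ₀ : 0 < ρ := by linarith
  have hbalance := hℓ.le_of_near_of_far hρ₀ (by positivity) (fun z hz =>
    neg_mul_sq_le_secondDifference_of_isMax_mul_parabola hx hvx hmax hz.1.le
      (by linarith [hz.2])) (hint.const_mul _) (fun y => by positivity)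
      fun y => div_sub_sq_le_mul_div_sq_add_sq hρ₀ (by linarith)
  rw [integral_const_mul, hρ] at hbalance
  have hfactor : 2 * v x / ρ - 40 * v x / (8 * ρ) ^ 2 * ρ - 5 * R ^ 2 / ρ ^ 2 * T =
      (11 * (v x * ρ) - 40 * (R ^ 2 * T)) / (8 * ρ ^ 2) := by
    field_simp
    ring
  have hle := (hfactor ▸ hbalance).trans hℓ₀
  rw [div_le_iff₀ (by positivity)] at hle
  rw [hρ]
  linarith [mul_nonneg (sq_nonneg R) hT]

theorem le_mul_integral_of_subharmonic (hv : Continuous v) (hR : 0 < R)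
    (hint : Integrable fun y => |v y| / (R ^ 2 + y ^ 2))
    (hsub : ∀ x, |x| < R → ∃ ℓ, HasSecondDifferenceIntegral v ℓ x ∧ ℓ ≤ 0) :
    v 0 ≤ 64 * R * ∫ y, |v y| / (R ^ 2 + y ^ 2) := by
  have : 0 ≤ ∫ y, |v y| / (R ^ 2 + y ^ 2) := integral_nonneg fun y => by positivity
  rcases le_or_gt (v 0) 0 with hv₀ | hv₀
  · exact hv₀.trans (by positivity)
  obtain ⟨x, hx, hvx, hmax⟩ := exists_isMax_mul_parabola hv hR hv₀
  obtain ⟨ℓ, hℓ, hℓ₀⟩ := hsub x hx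
  have : 0 < R - |x| := sub_pos.2 hx
  have hcenter : v 0 * R ^ 2 ≤ 64 * R * (∫ y, |v y| / (R ^ 2 + y ^ 2)) * R ^ 2 :=
    calc v 0 * R ^ 2 ≤ v x * (R ^ 2 - x ^ 2) := by simpa using hmax 0 (by simpa using hR.le)
      _ = v x * (R - |x|) * (R + |x|) := by
          rw [← sq_abs x]
          ring
      _ ≤ v x * (R - |x|) * (2 * R) := by
          gcongr
          linarith
      _ ≤ 32 * R ^ 2 * (∫ y, |v y| / (R ^ 2 + y ^ 2)) * (2 * R) := by
          gcongr ?_ * (2 * R)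
          exact mul_le_integral_of_isMax_mul_parabola hint hx hvx hmax hℓ hℓ₀
      _ = _ := by ring
  exact le_of_mul_le_mul_right hcenter (by positivity)

end InteriorEstimate

section Growth

variable {φ : ℝ → ℝ}

theorem MemLHalf.integrable_div_sq_add_sq (hφ : MemLHalf φ) {R : ℝ} (hR : 1 ≤ |R|) :
    Integrable fun y => |φ y| / (R ^ 2 + y ^ 2) := by
  have hR' : 1 ≤ R ^ 2 := one_le_sq_iff_one_le_abs R |>.2 hR
  refine hφ.2.mono' ?_ (Eventually.of_forall fun y => ?_)
  · exact (hφ.1.aestronglyMeasurable.aemeasurable.abs.div (by fun_prop)).aestronglyMeasurable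
  · rw [Real.norm_eq_abs, abs_of_nonneg (by positivity), sq_abs]
    gcongr

theorem MemLHalf.tendsto_integral_div_sq_add_sq (hφ : MemLHalf φ) :
    Tendsto (fun R : ℝ => ∫ y, |φ y| / (R ^ 2 + y ^ 2)) atTop (𝓝 0) := by
  rw [← integral_zero ℝ ℝ]
  refine tendsto_integral_filter_of_dominated_convergence (fun y => |φ y| / (1 + |y| ^ 2))
    ?_ ?_ hφ.2 (Eventually.of_forall fun y => ?_)
  · filter_upwards [eventually_ge_atTop 1] with R hR
    exact (hφ.integrable_div_sq_add_sq (hR.trans (le_abs_self R))).aestronglyMeasurable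
  · filter_upwards [eventually_ge_atTop 1] with R hR
    refine Eventually.of_forall fun y => ?_
    rw [Real.norm_eq_abs, abs_of_nonneg (by positivity), sq_abs]
    gcongr
    exact one_le_pow₀ hR
  · exact tendsto_const_nhds.div_atTop
      (tendsto_atTop_add_const_right _ _ (tendsto_pow_atTop two_ne_zero))

theorem abs_comp_add_left_div_le (φ : ℝ → ℝ) {c : ℝ} (hc : c ≠ 0) (y : ℝ) :
    |φ (c + y)| / (c ^ 2 + y ^ 2) ≤ 3 * (|φ (c + y)| / (c ^ 2 + (c + y) ^ 2)) := by
  have hc₂ : 0 < c ^ 2 := by positivity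
  rw [← mul_div_assoc, div_le_div_iff₀ (by positivity) (by positivity)]
  have hweight : c ^ 2 + (c + y) ^ 2 ≤ 3 * (c ^ 2 + y ^ 2) := by
    nlinarith [sq_nonneg (c - 2 * y)]
  linarith [mul_le_mul_of_nonneg_left hweight (abs_nonneg (φ (c + y)))]

theorem MemLHalf.integrable_comp_add_left_div (hφ : MemLHalf φ) {c : ℝ} (hc : 1 ≤ |c|) :
    Integrable fun y => |φ (c + y)| / (c ^ 2 + y ^ 2) := by
  have hc₀ : c ≠ 0 := abs_pos.1 (one_pos.trans_le hc)
  refine (((hφ.integrable_div_sq_add_sq hc).comp_add_left c).const_mul 3).mono' ?_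
    (Eventually.of_forall fun y => ?_)
  · have hmeas : AEStronglyMeasurable (fun y => φ (c + y)) :=
      hφ.1.aestronglyMeasurable.comp_measurePreserving (measurePreserving_add_left volume c)
    exact (hmeas.aemeasurable.abs.div (by fun_prop)).aestronglyMeasurable
  · rw [Real.norm_eq_abs, abs_of_nonneg (by positivity)]
    exact abs_comp_add_left_div_le φ hc₀ y

theorem MemLHalf.integral_comp_add_left_div_le (hφ : MemLHalf φ) {c : ℝ} (hc : 1 ≤ |c|) :
    ∫ y, |φ (c + y)| / (c ^ 2 + y ^ 2) ≤ 3 * ∫ y, |φ y| / (c ^ 2 + y ^ 2) := by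
  have hc₀ : c ≠ 0 := abs_pos.1 (one_pos.trans_le hc)
  calc _ ≤ ∫ y, 3 * (|φ (c + y)| / (c ^ 2 + (c + y) ^ 2)) :=
        integral_mono (hφ.integrable_comp_add_left_div hc)
          (((hφ.integrable_div_sq_add_sq hc).comp_add_left c).const_mul 3)
          (abs_comp_add_left_div_le φ hc₀)
    _ = _ := by
        rw [integral_const_mul, integral_add_left_eq_self (fun x => |φ x| / (c ^ 2 + x ^ 2)) c]

theorem eventually_neg_mul_abs_le_of_superharmonic (hφ : MemLHalf φ) (hc : Continuous φ)
    (hsuper : ∀ x, ∃ ℓ, HasSecondDifferenceIntegral φ ℓ x ∧ 0 ≤ ℓ) {δ : ℝ} (hδ : 0 < δ) :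
    ∀ᶠ x in cocompact ℝ, -(δ * |x|) ≤ φ x := by
  have hsmall := (hφ.tendsto_integral_div_sq_add_sq.comp
    (tendsto_norm_cocompact_atTop (E := ℝ))).eventually
    (gt_mem_nhds (by positivity : (0 : ℝ) < δ / 192))
  filter_upwards [hsmall, (tendsto_norm_cocompact_atTop (E := ℝ)).eventually_ge_atTop 1]
    with c hc_small hc_one
  simp only [Function.comp_apply, Real.norm_eq_abs, sq_abs] at hc_small hc_one
  have hestimate := le_mul_integral_of_subharmonic (v := fun y => -1 * φ (c + y)) (R := |c|)
    (by fun_prop) (one_pos.trans_le hc_one)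
    (by simpa using hφ.integrable_comp_add_left_div hc_one)
    fun x _ => by
      obtain ⟨ℓ, hℓ, hℓ₀⟩ := hsuper (c + x)
      exact ⟨_, hℓ.comp_add_left.const_mul (-1), by linarith⟩
  simp only [sq_abs, neg_mul, one_mul, abs_neg, add_zero] at hestimate
  have htranslate := hφ.integral_comp_add_left_div_le hc_one
  have hbound : 64 * |c| * ∫ y, |φ (c + y)| / (c ^ 2 + y ^ 2) ≤ 64 * |c| * (3 * (δ / 192)) := by
    gcongr
    linarith
  linarith

end Growth

/-- The standing assumptions on the nonlinearity: `G(0) = G'(0) = 0`, and `G'` is non-decreasing and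
`K`-Lipschitz on `[0, ∞)`. -/
structure IsAdmissibleNonlinearity (G : ℝ → ℝ) (K : NNReal) : Prop where
  differentiable : Differentiable ℝ G
  map_zero : G 0 = 0
  deriv_zero : deriv G 0 = 0
  monotoneOn_deriv : MonotoneOn (deriv G) (Ici 0)
  lipschitzOnWith_deriv : LipschitzOnWith K (deriv G) (Ici 0)

namespace IsAdmissibleNonlinearity

variable {G : ℝ → ℝ} {K : NNReal} {a b : ℝ}

theorem deriv_sub_nonneg (hG : IsAdmissibleNonlinearity G K) (ha : 0 ≤ a) (hab : a ≤ b) :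
    0 ≤ deriv G b - deriv G a :=
  sub_nonneg.2 (hG.monotoneOn_deriv ha (ha.trans hab) hab)

theorem deriv_sub_le (hG : IsAdmissibleNonlinearity G K) (ha : 0 ≤ a) (hab : a ≤ b) :
    deriv G b - deriv G a ≤ K * (b - a) := by
  simpa only [Real.dist_eq, abs_of_nonneg (hG.deriv_sub_nonneg ha hab),
    abs_of_nonneg (sub_nonneg.2 hab)] using
    hG.lipschitzOnWith_deriv.dist_le_mul b (ha.trans hab) a ha

theorem deriv_nonneg (hG : IsAdmissibleNonlinearity G K) (ha : 0 ≤ a) : 0 ≤ deriv G a := by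
  simpa [hG.deriv_zero] using hG.deriv_sub_nonneg le_rfl ha

theorem deriv_le (hG : IsAdmissibleNonlinearity G K) (ha : 0 ≤ a) : deriv G a ≤ K * a := by
  simpa [hG.deriv_zero] using hG.deriv_sub_le le_rfl ha

theorem sub_mem_Icc (hG : IsAdmissibleNonlinearity G K) (ha : 0 ≤ a) (hab : a ≤ b) :
    G b - G a ∈ Icc 0 (deriv G b * (b - a)) := by
  rcases hab.eq_or_lt with rfl | hlt
  · simp
  obtain ⟨ξ, hξ, hslope⟩ := exists_deriv_eq_slope G hlt hG.differentiable.continuous.continuousOn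
    hG.differentiable.differentiableOn
  have hξ₀ : 0 ≤ ξ := ha.trans hξ.1.le
  rw [eq_div_iff (sub_ne_zero.2 hlt.ne')] at hslope
  rw [← hslope]
  exact ⟨mul_nonneg (hG.deriv_nonneg hξ₀) (sub_nonneg.2 hab), mul_le_mul_of_nonneg_right
    (sub_nonneg.1 (hG.deriv_sub_nonneg hξ₀ hξ.2.le)) (sub_nonneg.2 hab)⟩

theorem nonneg (hG : IsAdmissibleNonlinearity G K) (ha : 0 ≤ a) : 0 ≤ G a := by
  simpa [hG.map_zero] using (hG.sub_mem_Icc le_rfl ha).1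

theorem neg_deriv_mul_le_sub (hG : IsAdmissibleNonlinearity G K) (ha : 0 ≤ a) (hb : 0 ≤ b)
    {N : ℝ} (hN : 0 ≤ N) (hab : -N ≤ a - b) : -(deriv G b * N) ≤ G a - G b := by
  have hg := hG.deriv_nonneg hb
  rcases le_total b a with hba | hab'
  · linarith [(hG.sub_mem_Icc hb hba).1, mul_nonneg hg hN]
  · have hN' : deriv G b * (b - a) ≤ deriv G b * N := by
      gcongr
      linarith
    linarith [(hG.sub_mem_Icc ha hab').2]

theorem neg_le_mul_deriv_sub (hG : IsAdmissibleNonlinearity G K) (ha : 0 ≤ a) (hab : a ≤ b)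
    {x y C : ℝ} (hC : 0 ≤ C) (hxy : -(C * (b - a)) ≤ x - y) :
    -(K * (max y 0 + C * b) * (b - a)) ≤ x * deriv G a - y * deriv G b := by
  have hdiff := hG.deriv_sub_nonneg ha hab
  have hfirst : y * (deriv G b - deriv G a) ≤ max y 0 * (K * (b - a)) :=
    (mul_le_mul_of_nonneg_right (le_max_left y 0) hdiff).trans
      (mul_le_mul_of_nonneg_left (hG.deriv_sub_le ha hab) (le_max_right y 0))
  have hga : deriv G a ≤ K * b := by linarith [hG.deriv_le (ha.trans hab)]
  have hsecond : -(C * (b - a) * (K * b)) ≤ (x - y) * deriv G a :=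
    calc -(C * (b - a) * (K * b)) ≤ -(C * (b - a) * deriv G a) :=
          neg_le_neg (mul_le_mul_of_nonneg_left hga (mul_nonneg hC (sub_nonneg.2 hab)))
      _ ≤ (x - y) * deriv G a := by
          rw [← neg_mul]
          exact mul_le_mul_of_nonneg_right hxy (hG.deriv_nonneg ha)
  linarith

end IsAdmissibleNonlinearity

/-- The difference `φ(c - s) - φ(c + s)` between the reflection of `φ` about `c` and `φ` itself, at
distance `s` to the right of the centre `c`. -/
def reflectionDiff (φ : ℝ → ℝ) (c s : ℝ) : ℝ :=
  φ (c - s) - φ (c + s)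

theorem odd_reflectionDiff (φ : ℝ → ℝ) (c : ℝ) : (reflectionDiff φ c).Odd := fun s => by
  simp only [reflectionDiff, sub_neg_eq_add, ← sub_eq_add_neg, neg_sub]

theorem continuous_reflectionDiff {φ : ℝ → ℝ} (hφ : Continuous φ) (c : ℝ) :
    Continuous (reflectionDiff φ c) := by
  unfold reflectionDiff
  fun_prop

theorem HasSecondDifferenceIntegral.reflectionDiff {φ : ℝ → ℝ} {c a ℓ ℓ' : ℝ}
    (hleft : HasSecondDifferenceIntegral φ ℓ (c - a))
    (hright : HasSecondDifferenceIntegral φ ℓ' (c + a)) :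
    HasSecondDifferenceIntegral (reflectionDiff φ c) (ℓ - ℓ') a := by
  have hreflected : HasSecondDifferenceIntegral (fun s => φ (c - s)) ℓ a :=
    hleft.congr_secondDifference fun z => by
      simp only [secondDifference, ← sub_sub, sub_add]
      ring
  have hsum := hreflected.add (hright.comp_add_left.const_mul (-1))
  simp only [neg_one_mul, ← sub_eq_add_neg] at hsum
  exact hsum

theorem tendsto_const_add_atTop_cocompact (c : ℝ) :
    Tendsto (fun s : ℝ => c + s) atTop (cocompact ℝ) :=
  (tendsto_atTop_add_const_left _ c tendsto_id).mono_right atTop_le_cocompact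

theorem tendsto_const_sub_atTop_cocompact (c : ℝ) :
    Tendsto (fun s : ℝ => c - s) atTop (cocompact ℝ) := by
  refine Tendsto.mono_right ?_ atBot_le_cocompact
  simp only [sub_eq_add_neg]
  exact tendsto_atBot_add_const_left _ c tendsto_neg_atTop_atBot

/-- The solutions of the system to which moving planes apply: `u` decays at least quadratically.
Both equations are multiplied by `π`. -/
structure IsDecayingSolution (G : ℝ → ℝ) (K : NNReal) (θ A : ℝ) (u w : ℝ → ℝ) : Prop where
  nonlinearity : IsAdmissibleNonlinearity G K
  θ_nonneg : 0 ≤ θ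
  continuous_u : Continuous u
  continuous_w : Continuous w
  w_mem : MemLHalf w
  eq_u : ∀ x, ∃ ℓ, HasSecondDifferenceIntegral u ℓ x ∧
    ℓ + π * u x = π * (θ * (w x * deriv G (u x)))
  eq_w : ∀ x, HasSecondDifferenceIntegral w (π * (π * G (u x))) x
  u_pos : ∀ x, 0 < u x
  u_le : ∀ x, u x ≤ A / (1 + x ^ 2)
  tendsto_w : Tendsto w (cocompact ℝ) atBot

namespace IsDecayingSolution

variable {G u w : ℝ → ℝ} {K : NNReal} {θ A : ℝ}

theorem const_nonneg (h : IsDecayingSolution G K θ A u w) : 0 ≤ A := by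
  simpa using (h.u_pos 0).le.trans (h.u_le 0)

theorem tendsto_u (h : IsDecayingSolution G K θ A u w) : Tendsto u (cocompact ℝ) (𝓝 0) := by
  have hlim : Tendsto (fun x => A * lorentzian 1 x) (cocompact ℝ) (𝓝 (A * 0)) :=
    (tendsto_lorentzian_cocompact 1).const_mul A
  rw [mul_zero] at hlim
  refine squeeze_zero (fun x => (h.u_pos x).le) (fun x => (h.u_le x).trans_eq ?_) hlim
  rw [lorentzian, one_pow, div_eq_mul_inv]

theorem u_le_const (h : IsDecayingSolution G K θ A u w) (x : ℝ) : u x ≤ A :=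
  (h.u_le x).trans (div_le_self h.const_nonneg (by linarith [sq_nonneg x]))

theorem tendsto_reflectionDiff_u (h : IsDecayingSolution G K θ A u w) (c : ℝ) :
    Tendsto (reflectionDiff u c) atTop (𝓝 0) := by
  rw [← sub_zero (0 : ℝ)]
  exact (h.tendsto_u.comp (tendsto_const_sub_atTop_cocompact c)).sub
    (h.tendsto_u.comp (tendsto_const_add_atTop_cocompact c))

theorem eventually_neg_mul_le_reflectionDiff_w (h : IsDecayingSolution G K θ A u w) (c : ℝ)
    {δ : ℝ} (hδ : 0 < δ) : ∀ᶠ s in atTop, -(δ * s) ≤ reflectionDiff w c s := by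
  have hlower := eventually_neg_mul_abs_le_of_superharmonic h.w_mem h.continuous_w
    (fun x => ⟨_, h.eq_w x, by
      have := h.nonlinearity.nonneg (h.u_pos x).le
      positivity⟩) (half_pos hδ)
  filter_upwards [(tendsto_const_sub_atTop_cocompact c).eventually hlower,
    (h.tendsto_w.comp (tendsto_const_add_atTop_cocompact c)).eventually_le_atBot 0,
    eventually_ge_atTop |c|] with s hleft hright hs
  have hcs : |c - s| ≤ 2 * s := by
    linarith [abs_sub c s, abs_of_nonneg ((abs_nonneg c).trans hs)]
  have hmul : δ / 2 * |c - s| ≤ δ / 2 * (2 * s) := by gcongr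
  simp only [Function.comp_apply] at hright
  rw [reflectionDiff]
  linarith

theorem mul_deriv_le (h : IsDecayingSolution G K θ A u w) {Λ c a : ℝ} (hc : Λ ≤ c) (ha : 0 ≤ a) :
    a * deriv G (u (c + a)) ≤ K * A * (1 + |Λ|) := by
  have hA := h.const_nonneg
  have hweight : a ≤ (1 + |Λ|) * (1 + (c + a) ^ 2) := by
    have hshift : a ≤ |c + a| + |Λ| := by linarith [le_abs_self (c + a), neg_abs_le Λ]
    rw [← sq_abs (c + a)]
    nlinarith [sq_nonneg (|c + a| - 1), mul_nonneg (abs_nonneg Λ) (sq_nonneg |c + a|)]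
  calc a * deriv G (u (c + a)) ≤ a * (K * (A / (1 + (c + a) ^ 2))) := by
        gcongr
        exact (h.nonlinearity.deriv_le (h.u_pos _).le).trans (by gcongr; exact h.u_le _)
    _ ≤ (1 + |Λ|) * (1 + (c + a) ^ 2) * (K * (A / (1 + (c + a) ^ 2))) := by gcongr
    _ = K * A * (1 + |Λ|) := by
        field_simp

theorem exists_neg_le_reflectionDiff_w (h : IsDecayingSolution G K θ A u w) (Λ : ℝ) :
    ∃ C, 0 ≤ C ∧ ∀ c, Λ ≤ c → ∀ N, 0 ≤ N → (∀ s, 0 < s → -N ≤ reflectionDiff u c s) →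
      ∀ s, 0 < s → -(C * N) ≤ reflectionDiff w c s := by
  have hA := h.const_nonneg
  have hC : 0 ≤ π ^ 2 / 2 * (K * A * (1 + |Λ|)) := by positivity
  refine ⟨_, hC, fun c hc N hN hU s hs => ?_⟩
  refine neg_le_of_odd_of_sublinear (odd_reflectionDiff w c)
    (continuous_reflectionDiff h.continuous_w c)
    (fun δ hδ => h.eventually_neg_mul_le_reflectionDiff_w c hδ) (mul_nonneg hC hN)
    (fun a ha => ⟨_, (h.eq_w (c - a)).reflectionDiff (h.eq_w (c + a)), ?_⟩) hs
  have hG := h.nonlinearity.neg_deriv_mul_le_sub (h.u_pos (c - a)).le (h.u_pos (c + a)).le hN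
    (hU a ha)
  calc -(2 * (π ^ 2 / 2 * (K * A * (1 + |Λ|)) * N) / a) =
        -(π ^ 2 * (K * A * (1 + |Λ|) * N / a)) := by ring
    _ ≤ -(π ^ 2 * (deriv G (u (c + a)) * N)) := by
        gcongr
        rw [le_div_iff₀ ha]
        linarith [mul_le_mul_of_nonneg_right (h.mul_deriv_le hc ha.le) hN]
    _ ≤ π ^ 2 * (G (u (c - a)) - G (u (c + a))) := by
        rw [← mul_neg]
        gcongr
    _ = π * (π * G (u (c - a))) - π * (π * G (u (c + a))) := by ring

theorem exists_reflectionDiff_u (h : IsDecayingSolution G K θ A u w) (c a : ℝ) :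
    ∃ ℓ, HasSecondDifferenceIntegral (reflectionDiff u c) ℓ a ∧
      ℓ + π * reflectionDiff u c a =
        π * (θ * (w (c - a) * deriv G (u (c - a)) - w (c + a) * deriv G (u (c + a)))) := by
  obtain ⟨ℓ, hℓ, heq⟩ := h.eq_u (c - a)
  obtain ⟨ℓ', hℓ', heq'⟩ := h.eq_u (c + a)
  refine ⟨ℓ - ℓ', hℓ.reflectionDiff hℓ', ?_⟩
  rw [reflectionDiff]
  linarith

theorem two_div_add_pi_le_of_isMin (h : IsDecayingSolution G K θ A u w) {C c a : ℝ} (hC : 0 ≤ C)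
    (ha : 0 < a) (hneg : reflectionDiff u c a < 0)
    (hmin : ∀ s, 0 < s → reflectionDiff u c a ≤ reflectionDiff u c s)
    (hw : -(C * -reflectionDiff u c a) ≤ reflectionDiff w c a) :
    2 / a + π ≤ π * (θ * (K * (max (w (c + a)) 0 + C * u (c + a)))) := by
  have hθ := h.θ_nonneg
  obtain ⟨ℓ, hℓ, heq⟩ := h.exists_reflectionDiff_u c a
  have hle := hℓ.le_two_mul_div_of_odd_of_isMin (odd_reflectionDiff u c)
    (continuous_reflectionDiff h.continuous_u c) ha hmin
  have hN : -reflectionDiff u c a = u (c + a) - u (c - a) := neg_sub _ _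
  have hreaction := h.nonlinearity.neg_le_mul_deriv_sub (h.u_pos (c - a)).le
    (by linarith) hC (hN ▸ hw)
  rw [← hN] at hreaction
  have hscaled := mul_le_mul_of_nonneg_left
    (mul_le_mul_of_nonneg_left hreaction hθ) Real.pi_pos.le
  refine le_of_mul_le_mul_right ?_ (neg_pos.2 hneg)
  have hsplit : (2 / a + π) * -reflectionDiff u c a =
      -(2 * reflectionDiff u c a / a + π * reflectionDiff u c a) := by ring
  rw [hsplit]
  linarith

theorem exists_reflectionDiff_neg_near (h : IsDecayingSolution G K θ A u w) (Λ : ℝ) :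
    ∃ R δ : ℝ, 0 < δ ∧ ∀ c, Λ ≤ c → (∃ s, 0 < s ∧ reflectionDiff u c s < 0) →
      ∃ s, δ ≤ s ∧ c + s ≤ R ∧ reflectionDiff u c s < 0 := by
  obtain ⟨C, hC, hwC⟩ := h.exists_neg_le_reflectionDiff_w Λ
  have hθ := h.θ_nonneg
  have hA := h.const_nonneg
  obtain ⟨x₁, hx₁⟩ := h.continuous_w.exists_forall_ge h.tendsto_w
  have hfar : ∀ᶠ x in atTop, π * (θ * (K * (max (w x) 0 + C * u x))) < π := by
    have hlim := ((((h.tendsto_u.mono_left atTop_le_cocompact).const_mul C).const_mul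
      (K : ℝ)).const_mul θ).const_mul π
    simp only [mul_zero] at hlim
    filter_upwards [hlim.eventually (gt_mem_nhds Real.pi_pos),
      (h.tendsto_w.mono_left atTop_le_cocompact).eventually_le_atBot 0] with x hx hwx
    rwa [max_eq_right hwx, zero_add]
  obtain ⟨R, hR⟩ := eventually_atTop.1 hfar
  refine ⟨R, 2 / (π * (θ * (K * (max (w x₁) 0 + C * A))) + 1), by positivity, ?_⟩
  rintro c hc ⟨s, hs, hneg⟩
  obtain ⟨a, ha, has, hmin⟩ := exists_isMinOn_Ioi_zero
    (continuous_reflectionDiff h.continuous_u c) (odd_reflectionDiff u c).map_zero hs hneg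
    ((h.tendsto_reflectionDiff_u c).eventually (le_mem_nhds hneg))
  have ha_neg := has.trans_lt hneg
  have hcritical := h.two_div_add_pi_le_of_isMin hC ha ha_neg hmin
    (hwC c hc _ (neg_pos.2 ha_neg).le (fun t ht => (neg_neg _).trans_le (hmin t ht)) a ha)
  have ha₂ : 0 < 2 / a := by positivity
  refine ⟨a, ?_, ?_, ha_neg⟩
  · have hbound : π * (θ * (K * (max (w (c + a)) 0 + C * u (c + a)))) ≤
        π * (θ * (K * (max (w x₁) 0 + C * A))) := by
      gcongr
      · exact hx₁ _
      · exact h.u_le_const _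
    rw [div_le_comm₀ (by positivity) ha]
    linarith [Real.pi_pos]
  · by_contra! hRa
    linarith [hR _ hRa.le]

theorem symmetric_of_reflectionDiff_eq_zero (h : IsDecayingSolution G K θ A u w) {c a : ℝ}
    (hnonneg : ∀ s, 0 < s → 0 ≤ reflectionDiff u c s) (ha : 0 < a)
    (hzero : reflectionDiff u c a = 0) (x : ℝ) : u (c + x) = u (c - x) := by
  obtain ⟨C, -, hC⟩ := h.exists_neg_le_reflectionDiff_w c
  have hw : 0 ≤ reflectionDiff w c a := by
    simpa using hC c le_rfl 0 le_rfl (by simpa using hnonneg) a ha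
  obtain ⟨ℓ, hℓ, heq⟩ := h.exists_reflectionDiff_u c a
  have hℓ₀ : 0 ≤ ℓ := by
    rw [hzero, mul_zero, add_zero, sub_eq_zero.1 hzero, ← sub_mul] at heq
    rw [heq]
    exact mul_nonneg Real.pi_pos.le (mul_nonneg h.θ_nonneg
      (mul_nonneg hw (h.nonlinearity.deriv_nonneg (h.u_pos _).le)))
  have hpos : ∀ b, 0 < b → reflectionDiff u c b = 0 := fun b hb => by
    by_contra hne
    exact hℓ₀.not_gt (hℓ.neg_of_odd_of_nonneg (odd_reflectionDiff u c)
      (continuous_reflectionDiff h.continuous_u c) ha hzero hnonneg hb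
      ((hnonneg b hb).lt_of_ne' hne))
  have hall : reflectionDiff u c x = 0 := by
    rcases lt_trichotomy x 0 with hx | rfl | hx
    · rw [← neg_neg x, odd_reflectionDiff, hpos _ (neg_pos.2 hx), neg_zero]
    · exact (odd_reflectionDiff u c).map_zero
    · exact hpos x hx
  exact (sub_eq_zero.1 hall).symm

end IsDecayingSolution

section Periodic

variable {u : ℝ → ℝ}

theorem periodic_of_symmetric_of_symmetric {c d : ℝ} (hc : ∀ x, u (c + x) = u (c - x))
    (hd : ∀ x, u (d + x) = u (d - x)) : u.Periodic (2 * (d - c)) := fun x =>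
  calc u (x + 2 * (d - c)) = u (d + (x + d - 2 * c)) := by ring_nf
    _ = u (c + (c - x)) := by rw [hd]; ring_nf
    _ = u x := by rw [hc, sub_sub_cancel]

theorem eq_of_periodic_of_tendsto_atTop {T l : ℝ} (hu : u.Periodic T) (hT : 0 < T)
    (hlim : Tendsto u atTop (𝓝 l)) (x : ℝ) : u x = l := by
  have hshift : Tendsto (fun n : ℕ => x + n * T) atTop atTop :=
    tendsto_atTop_add_const_left _ x (tendsto_natCast_atTop_atTop.atTop_mul_const hT)
  exact tendsto_nhds_unique tendsto_const_nhds
    ((hlim.comp hshift).congr fun n => hu.nat_mul n x)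

end Periodic

/-- The centres at which moving planes has not yet succeeded: reflecting the graph of `u` about `c`
does not place it above `u` everywhere to the right of `c`. -/
def violatingCenters (u : ℝ → ℝ) : Set ℝ :=
  {c | ∃ s, 0 < s ∧ reflectionDiff u c s < 0}

section ViolatingCenters

variable {u : ℝ → ℝ} {c : ℝ}

theorem violatingCenters_nonempty (hpos : 0 < u 0) (hlim : Tendsto u atBot (𝓝 0)) :
    (violatingCenters u).Nonempty := by
  obtain ⟨y, hy, hy₀⟩ := ((hlim.eventually (gt_mem_nhds hpos)).and (eventually_lt_atBot 0)).exists
  refine ⟨y / 2, -(y / 2), by linarith, ?_⟩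
  rw [reflectionDiff, sub_neg_eq_add, add_halves, add_neg_cancel]
  linarith

theorem reflectionDiff_nonneg_of_sSup_violatingCenters_le (hu : Continuous u)
    (hbdd : BddAbove (violatingCenters u)) (hc : sSup (violatingCenters u) ≤ c) {s : ℝ}
    (hs : 0 < s) : 0 ≤ reflectionDiff u c s := by
  have hcont : Continuous fun c' => reflectionDiff u c' s := by
    unfold reflectionDiff
    fun_prop
  refine ge_of_tendsto ((hcont.tendsto c).mono_left (nhdsWithin_le_nhds (s := Ioi c))) ?_
  filter_upwards [self_mem_nhdsWithin] with c' hc'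
  by_contra! hneg
  exact ((le_csSup hbdd ⟨s, hs, hneg⟩).trans hc).not_gt hc'

theorem eventually_forall_Icc_reflectionDiff_pos (hu : Continuous u) {a b : ℝ}
    (hpos : ∀ s ∈ Icc a b, 0 < reflectionDiff u c s) :
    ∀ᶠ c' in 𝓝 c, ∀ s ∈ Icc a b, 0 < reflectionDiff u c' s := by
  have hcont : Continuous fun p : ℝ × ℝ => reflectionDiff u p.1 p.2 := by
    unfold reflectionDiff
    fun_prop
  exact isCompact_Icc.eventually_forall_of_forall_eventually fun s hs =>
    hcont.continuousAt.eventually (lt_mem_nhds (hpos s hs))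

end ViolatingCenters

namespace IsDecayingSolution

variable {G u w : ℝ → ℝ} {K : NNReal} {θ A : ℝ}

theorem bddAbove_violatingCenters (h : IsDecayingSolution G K θ A u w) :
    BddAbove (violatingCenters u) := by
  obtain ⟨R, δ, hδ, hnear⟩ := h.exists_reflectionDiff_neg_near 0
  refine ⟨max 0 R, fun c hc => ?_⟩
  by_contra! hlt
  obtain ⟨s, hs, hsR, -⟩ := hnear c ((le_max_left 0 R).trans hlt.le) hc
  linarith [le_max_right 0 R]

theorem symmetric_about_sSup_violatingCenters (h : IsDecayingSolution G K θ A u w) (x : ℝ) :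
    u (sSup (violatingCenters u) + x) = u (sSup (violatingCenters u) - x) := by
  have hne := violatingCenters_nonempty (h.u_pos 0) (h.tendsto_u.mono_left atBot_le_cocompact)
  set c₀ := sSup (violatingCenters u)
  have hnonneg : ∀ s, 0 < s → 0 ≤ reflectionDiff u c₀ s := fun s =>
    reflectionDiff_nonneg_of_sSup_violatingCenters_le h.continuous_u h.bddAbove_violatingCenters
      le_rfl
  suffices hzero : ∃ a, 0 < a ∧ reflectionDiff u c₀ a = 0 by
    obtain ⟨a, ha, hza⟩ := hzero
    exact h.symmetric_of_reflectionDiff_eq_zero hnonneg ha hza x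
  by_contra! hnonzero
  obtain ⟨R, δ, hδ, hnear⟩ := h.exists_reflectionDiff_neg_near (c₀ - 1)
  have hstable := eventually_forall_Icc_reflectionDiff_pos h.continuous_u (c := c₀) (a := δ)
    (b := R - c₀ + 1) fun s hs =>
      (hnonneg s (hδ.trans_le hs.1)).lt_of_ne' (hnonzero s (hδ.trans_le hs.1))
  obtain ⟨c, hc, hpos, hc₁⟩ := ((isLUB_csSup hne h.bddAbove_violatingCenters).frequently_mem
    hne |>.and_eventually (nhdsWithin_le_nhds
      (hstable.and (lt_mem_nhds (sub_one_lt c₀))))).exists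
  obtain ⟨s, hs, hsR, hneg⟩ := hnear c hc₁.le hc
  exact (hpos s ⟨hs, by linarith⟩).not_gt hneg

theorem reflectionDiff_pos_of_sSup_violatingCenters_lt (h : IsDecayingSolution G K θ A u w)
    {c s : ℝ} (hc : sSup (violatingCenters u) < c) (hs : 0 < s) : 0 < reflectionDiff u c s := by
  have hnonneg : ∀ s, 0 < s → 0 ≤ reflectionDiff u c s := fun s =>
    reflectionDiff_nonneg_of_sSup_violatingCenters_le h.continuous_u h.bddAbove_violatingCenters
      hc.le
  refine (hnonneg s hs).lt_of_ne' fun hzero => (h.u_pos 0).ne' ?_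
  have hperiodic := periodic_of_symmetric_of_symmetric h.symmetric_about_sSup_violatingCenters
    (h.symmetric_of_reflectionDiff_eq_zero hnonneg hs hzero)
  exact eq_of_periodic_of_tendsto_atTop hperiodic (by linarith)
    (h.tendsto_u.mono_left atTop_le_cocompact) 0

theorem strictAntiOn_add_sSup_violatingCenters (h : IsDecayingSolution G K θ A u w) :
    StrictAntiOn (fun r => u (sSup (violatingCenters u) + r)) (Ici 0) := by
  intro r hr t _ hrt
  set c₀ := sSup (violatingCenters u)
  have hpos := h.reflectionDiff_pos_of_sSup_violatingCenters_lt (c := c₀ + (r + t) / 2)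
    (s := (t - r) / 2) (by linarith [mem_Ici.1 hr]) (by linarith)
  have hleft : c₀ + (r + t) / 2 - (t - r) / 2 = c₀ + r := by ring
  have hright : c₀ + (r + t) / 2 + (t - r) / 2 = c₀ + t := by ring
  rwa [reflectionDiff, hleft, hright, sub_pos] at hpos

end IsDecayingSolution

theorem bddAbove_range_of_memLp_top {u : ℝ → ℝ} (hu : Continuous u) (h : MemLp u ⊤ volume) :
    BddAbove (range u) := by
  have hae : ∀ᵐ x, u x ≤ (eLpNormEssSup u volume).toReal := by
    have hfin : eLpNormEssSup u volume ≠ ⊤ := by simpa using h.2.ne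
    filter_upwards [ae_le_eLpNormEssSup (f := u) (μ := volume)] with x hx
    calc u x ≤ ‖u x‖ := Real.le_norm_self _
      _ = ‖u x‖ₑ.toReal := (toReal_enorm _).symm
      _ ≤ _ := ENNReal.toReal_mono hfin hx
  have hclosed : IsClosed {x | u x ≤ (eLpNormEssSup u volume).toReal} :=
    isClosed_le hu continuous_const
  refine ⟨(eLpNormEssSup u volume).toReal, forall_mem_range.2 fun x => ?_⟩
  exact hclosed.closure_subset (Measure.dense_of_ae hae x)

theorem MemLHalf.of_abs_le {φ : ℝ → ℝ} (hφ : Continuous φ) {M : ℝ} (hM : ∀ x, |φ x| ≤ M) :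
    MemLHalf φ := by
  refine ⟨hφ.locallyIntegrable, (integrable_inv_one_add_sq.const_mul M).mono'
    (Continuous.aestronglyMeasurable ?_) (Eventually.of_forall fun x => ?_)⟩
  · exact hφ.abs.div (by fun_prop) fun x => by positivity
  · rw [Real.norm_eq_abs, abs_of_nonneg (by positivity), sq_abs, ← div_eq_mul_inv]
    gcongr
    exact hM x

theorem theorem1p6_general {G u w : ℝ → ℝ} {K : NNReal} {θ : ℝ}
    (hG : IsAdmissibleNonlinearity G K) (hθ : 0 ≤ θ) (hu : Continuous u) (hw : Continuous w)
    (hw_mem : MemLHalf w)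
    (heq_u : ∀ x, ∃ L, HasHalfLaplacianAt u L x ∧ L + u x = θ * w x * deriv G (u x))
    (heq_w : ∀ x, HasHalfLaplacianAt w (π * G (u x)) x)
    (hupos : ∀ x, 0 < u x) (hubdd : BddAbove (range u)) (hwlim : Tendsto w (cocompact ℝ) atBot) :
    ∃ x₀ : ℝ, (∀ x : ℝ, u (x₀ + x) = u (x₀ - x)) ∧
      StrictAntiOn (fun r : ℝ => u (x₀ + r)) (Ici 0) := by
  obtain ⟨M, hM⟩ := hubdd
  rw [mem_upperBounds, forall_mem_range] at hM
  have hu_mem : MemLHalf u := .of_abs_le hu fun x => (abs_of_pos (hupos x)).trans_le (hM x)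
  have heq : ∀ x, ∃ ℓ, HasSecondDifferenceIntegral u ℓ x ∧
      ℓ + π * u x = π * (θ * (w x * deriv G (u x))) := fun x => by
    obtain ⟨L, hL, hLeq⟩ := heq_u x
    exact ⟨π * L, hL.hasSecondDifferenceIntegral hu_mem, by rw [← mul_add, hLeq, mul_assoc]⟩
  obtain ⟨R, hR⟩ : ∃ R : ℝ, ∀ x, R < |x| → w x ≤ 0 := by
    have hev := hwlim.eventually_le_atBot 0
    rw [← Metric.cobounded_eq_cocompact] at hev
    obtain ⟨R, -, hR⟩ := hasBasis_cobounded_norm.eventually_iff.1 hev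
    exact ⟨R, fun x hx => hR (le_of_lt hx)⟩
  obtain ⟨A, hA⟩ := exists_le_div_one_add_sq hu ((hupos 0).le.trans (hM 0)) hM fun x hx => by
    obtain ⟨ℓ, hℓ, hle⟩ := heq x
    refine ⟨ℓ, hℓ, hle.trans_le (mul_nonpos_of_nonneg_of_nonpos Real.pi_pos.le ?_)⟩
    exact mul_nonpos_of_nonneg_of_nonpos hθ
      (mul_nonpos_of_nonpos_of_nonneg (hR x hx) (hG.deriv_nonneg (hupos x).le))
  have h : IsDecayingSolution G K θ A u w :=
    ⟨hG, hθ, hu, hw, hw_mem, heq, fun x => (heq_w x).hasSecondDifferenceIntegral hw_mem, hupos,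
      hA, hwlim⟩
  exact ⟨_, h.symmetric_about_sSup_violatingCenters, h.strictAntiOn_add_sSup_violatingCenters⟩

theorem theorem1p6 (G : ℝ → ℝ) (hG : ContDiff ℝ 1 G) (hG0 : G 0 = 0) (hg0 : deriv G 0 = 0)
    (hgmono : MonotoneOn (deriv G) (Set.Ici 0))
    (hglip : ∃ K : NNReal, LipschitzOnWith K (deriv G) (Set.Ici 0))
    (θ : ℝ) (hθ : 0 < θ) (u w : ℝ → ℝ) (hsol : IsClassicalSolution G θ u w)
    (hupos : ∀ x : ℝ, 0 < u x) (hubdd : MeasureTheory.MemLp u ⊤ MeasureTheory.volume)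
    (hw : Filter.Tendsto w (Filter.cocompact ℝ) Filter.atBot) :
    ∃ x₀ : ℝ, (∀ x : ℝ, u (x₀ + x) = u (x₀ - x)) ∧
      StrictAntiOn (fun r : ℝ => u (x₀ + r)) (Set.Ici 0) := by
  obtain ⟨K, hK⟩ := hglip
  have huc : Continuous u := hsol.u_c11.1.continuous
  exact theorem1p6_general ⟨hG.differentiable one_ne_zero, hG0, hg0, hgmono, hK⟩ hθ.le huc
    hsol.w_c11.1.continuous hsol.w_mem hsol.eq_u hsol.eq_w hupos
    (bddAbove_range_of_memLp_top huc hubdd) hw
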